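/- Let $p\in(1,2]$, $c>0$, $0\le\nu_p<\infty$. Consider a stochastic bandit with $K$ arms: in round $t$ the reward $\mathbf R_{t,a}$ of arm $a$ has a law that does not depend on $t$, with mean $r_a$ and $\mathbb E|\mathbf R_{t,a}|^p\le\nu_p$, and rewards of a round are independent of the past and of the choice and the perturbations of that round. Put $r_{a^\star}=\max_a r_a$ and $\Delta_a=r_{a^\star}-r_a$. Let $F(g)=\mathbb P(G<g)$ be the distribution function of a real random variable $G$ whose support is unbounded above (that is, $F(x)<1$ for all $x$), such that $F$ is log-concave, $F(0)\le 1/2$, and, with the hazard rate $h(x)=\frac{d}{dx}\log(1-F(x))^{-1}$, $\int_0^\infty\frac{h(x)e^{-x}}{1-F(x)}\,dx\le C_F<\infty$ for some constant $C_F$. Write $F^{-1}(y)=\inf\{x: F(x)\ge y\}$ for $0<y<1$, with any value (say $0$) where this infimum is not a real number, and $[x]_+=\max(x,0)$. Let $b_p=\big[2\big(\tfrac{2-p}{p-1}\big)^{1-2/p}+\big(\tfrac{2-p}{p-1}\big)^{2-2/p}\big]^{-p/2}$ (with $0^0=1$) and $\psi_p(x)=\ln(b_p|x|^p+x+1)$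 for $x\ge0$, $\psi_p(x)=-\ln(b_p|x|^p-x+1)$ for $x<0$. The algorithm APE$^2$ chooses each arm once in the first $K$ rounds, and in every later round $t$ it chooses $a_t\in\arg\max_a\{\hat r_{t-1,a}+\beta_{t-1,a}G_{t,a}\}$ (ties broken in any non-anticipating way), where $n=n_{t-1,a}$ is the number of times that $a$ was chosen before round $t$, $\hat r_{t-1,a}=\frac{c}{n^{1-1/p}}\sum_{k<t,\,a_k=a}\psi_p\big(\frac{\mathbf R_{k,a}}{c\,n^{1/p}}\big)$ is the $p$-robust estimator, $\beta_{t-1,a}=c/n^{1-1/p}$, and the $G_{t,a}$ are independent copies of $G$, drawn afresh in each round, independently of the past actions and received rewards. Then there are an absolute constant $M>0$ and a constant $C=C_{c,p,\nu_p,F}>0$, which depends only on $c,p,\nu_p,F$ (in particular not on $T$, on $K$ or on the reward laws), such that for every such bandit and every $T\ge1$ the expected regret $\mathbb E[\mathcal R_T]=\sum_{t=1}^T\big(r_{a^\star}-\mathbb E[r_{a_t}]\big)$ of APE$^2$ satisfies $$\mathbb E[\mathcal R_T]\le M\sum_{a:\,\Delta_a>0}\Bigg(\frac{C}{\Delta_a^{\frac1{p-1}}}+\frac{(6c)^{\frac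 p{p-1}}}{\Delta_a^{\frac1{p-1}}}\Big[-F^{-1}\Big(\frac{c^{\frac p{p-1}}}{T\Delta_a^{\frac p{p-1}}}\Big)\Big]_+^{\frac p{p-1}}+\frac{(3c)^{\frac p{p-1}}}{\Delta_a^{\frac1{p-1}}}\Big[F^{-1}\Big(1-\frac{c^{\frac p{p-1}}}{T\Delta_a^{\frac p{p-1}}}\Big)\Big]_+^{\frac p{p-1}}+\Delta_a\Bigg).$$ -/

import Mathlib

open MeasureTheory ProbabilityTheory
open scoped ENNReal NNReal

noncomputable section

namespace APE2

/-! ### The perturbation -/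

/-- The distribution function `F(g) = ℙ(G < g)` of a perturbation `G` with law `μ`. -/
def pertCDF (μ : Measure ℝ) (g : ℝ) : ℝ := μ.real (Set.Iio g)

/-- The (generalized) inverse `F⁻¹(y) = inf {x | y ≤ F(x)}`, for `0 < y < 1`. Where this infimum is
not a real number (possible only for `y ≤ 0` or `y ≥ 1`) the value is `0`. -/
def pertInv (μ : Measure ℝ) (y : ℝ) : ℝ := sInf {x : ℝ | y ≤ pertCDF μ x}

/-- The hazard rate `h(x) = d/dx log (1 - F(x))⁻¹`. -/
def hazard (μ : Measure ℝ) (x : ℝ) : ℝ :=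
  deriv (fun y : ℝ => Real.log (1 - pertCDF μ y)⁻¹) x

/-- The conditions on the law `μ` of the perturbation. Log-concavity is written multiplicatively, so
that it allows `F = 0` on a left half-line; together with `F < 1` it makes `F` locally absolutely
continuous on the interior of `{F > 0}`, so `h` is the true derivative almost everywhere there. -/
structure PerturbationAssumption (μ : Measure ℝ) : Prop where
  /-- the support is unbounded (above) -/
  unbounded : ∀ x : ℝ, pertCDF μ x < 1
  /-- `F` is log-concave -/
  logConcave : ∀ x y s : ℝ, 0 < s → s < 1 →
    pertCDF μ x ^ s * pertCDF μ y ^ (1 - s) ≤ pertCDF μ (s * x + (1 - s) * y)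
  /-- `F(0) ≤ 1/2` -/
  half : pertCDF μ 0 ≤ 1 / 2
  /-- `∫₀^∞ h(x) exp(-x) / (1 - F(x)) dx ≤ C_F < ∞` for some constant `C_F` -/
  hazard_integral : ∃ CF : ℝ≥0,
    ∫⁻ x in Set.Ioi (0 : ℝ),
      ENNReal.ofReal (hazard μ x * Real.exp (-x) / (1 - pertCDF μ x)) ≤ (CF : ℝ≥0∞)

/-! ### The `p`-robust estimator -/

/-- The constant `b_p`. -/
def bConst (p : ℝ) : ℝ :=
  (2 * ((2 - p) / (p - 1)) ^ (1 - 2 / p) + ((2 - p) / (p - 1)) ^ (2 - 2 / p)) ^ (-(p / 2))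

/-- The influence function `ψ_p`. -/
def influence (p x : ℝ) : ℝ :=
  if 0 ≤ x then Real.log (bConst p * |x| ^ p + x + 1)
  else -Real.log (bConst p * |x| ^ p - x + 1)

/-- The number of rounds `s < t` in which arm `a` was chosen. Rounds are numbered `0, 1, 2, …`, so
this is the count before round `t`. -/
def pulls {K : ℕ} (act : ℕ → Fin K) (t : ℕ) (a : Fin K) : ℕ :=
  ((Finset.range t).filter fun s => act s = a).card

/-- The `p`-robust estimate of the mean of arm `a`, from its `n` rewards seen before round `t`:
`c / n^(1-1/p) * ∑ ψ_p (reward / (c n^(1/p)))`. -/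
def estimate {K : ℕ} (p c : ℝ) (act : ℕ → Fin K) (rew : ℕ → Fin K → ℝ) (t : ℕ) (a : Fin K) : ℝ :=
  c / (pulls act t a : ℝ) ^ (1 - 1 / p) *
    ∑ s ∈ (Finset.range t).filter fun s => act s = a,
      influence p (rew s a / (c * (pulls act t a : ℝ) ^ (1 / p)))

/-- The perturbed estimate `r̂_{t-1,a} + β_{t-1,a} G_{t,a}` with `β_{t-1,a} = c / n^(1-1/p)`. -/
def perturbedEstimate {K : ℕ} (p c : ℝ) (act : ℕ → Fin K) (rew pert : ℕ → Fin K → ℝ)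
    (t : ℕ) (a : Fin K) : ℝ :=
  estimate p c act rew t a + c / (pulls act t a : ℝ) ^ (1 - 1 / p) * pert t a

/-! ### The algorithm -/

/-- The history before round `t`: the σ-algebra generated by the chosen arms and the received
rewards in the rounds `s < t`. -/
@[reducible] def history {Ω : Type*} {K : ℕ} (A : ℕ → Ω → Fin K) (R : ℕ → Ω → Fin K → ℝ) (t : ℕ) :
    MeasurableSpace Ω :=
  ⨆ s ∈ Finset.range t,
    MeasurableSpace.comap (fun ω => (A s ω, R s ω (A s ω))) inferInstance

/-- `(R, G, A)` is a run of APE² with parameters `p`, `c` and perturbation law `μ` on the `K`-armed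
bandit with reward laws `D`. Here `R t ω a`, `G t ω a` are the reward and the perturbation of arm
`a` in round `t` and `A t ω` is the chosen arm. Every arm is chosen once in the first `K` rounds;
afterwards an arm with maximal perturbed estimate is chosen (ties are broken in any
way that does not look at the rewards of the current round). -/
structure IsRun {Ω : Type*} [MeasurableSpace Ω] (P : Measure Ω) {K : ℕ} (p c : ℝ)
    (D : Fin K → Measure ℝ) (μ : Measure ℝ)
    (R G : ℕ → Ω → Fin K → ℝ) (A : ℕ → Ω → Fin K) : Prop where
  measurable_R : ∀ t, Measurable (R t)
  measurable_G : ∀ t, Measurable (G t)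
  measurable_A : ∀ t, Measurable (A t)
  /-- the reward of arm `a` has law `D a` in every round -/
  law_R : ∀ t a, P.map (fun ω => R t ω a) = D a
  /-- the perturbations of a round are independent with law `μ` -/
  law_G : ∀ t, P.map (G t) = Measure.pi fun _ => μ
  /-- the perturbations of a round are fresh -/
  indep_G : ∀ t, Indep (history A R t) (MeasurableSpace.comap (G t) inferInstance) P
  /-- the rewards of a round are independent of the past, and of the perturbations and the choice
  of the round -/
  indep_R : ∀ t, Indep
    (history A R t ⊔ MeasurableSpace.comap (fun ω => (G t ω, A t ω)) inferInstance)
    (MeasurableSpace.comap (R t) inferInstance) P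
  /-- initialization -/
  init : ∀ (t : ℕ) (ht : t < K) (ω : Ω), A t ω = ⟨t, ht⟩
  /-- decision rule -/
  argmax : ∀ t : ℕ, K ≤ t → ∀ (ω : Ω) (a : Fin K),
    perturbedEstimate p c (fun s => A s ω) (fun s => R s ω) (fun s => G s ω) t a ≤
      perturbedEstimate p c (fun s => A s ω) (fun s => R s ω) (fun s => G s ω) t (A t ω)

/-! ### Regret -/

/-- The mean reward `r_a`. -/
def meanReward {K : ℕ} (D : Fin K → Measure ℝ) (a : Fin K) : ℝ := ∫ x, x ∂(D a)

/-- The mean reward `r_{a⋆} = max_a r_a` of an optimal arm. -/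
def bestMean {K : ℕ} (D : Fin K → Measure ℝ) : ℝ := ⨆ a, meanReward D a

/-- The gap `Δ_a = r_{a⋆} - r_a`. -/
def gap {K : ℕ} (D : Fin K → Measure ℝ) (a : Fin K) : ℝ := bestMean D - meanReward D a

/-- The expected cumulative regret over `T` rounds, `∑_t (r_{a⋆} - 𝔼[r_{a_t}])`. -/
def expectedRegret {Ω : Type*} [MeasurableSpace Ω] (P : Measure Ω) {K : ℕ}
    (D : Fin K → Measure ℝ) (A : ℕ → Ω → Fin K) (T : ℕ) : ℝ :=
  ∑ t ∈ Finset.range T, (bestMean D - ∫ ω, meanReward D (A t ω) ∂P)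

/-- The expression attached to an arm with gap `Δ > 0` in the regret bound. -/
def armBound (p c : ℝ) (μ : Measure ℝ) (C : ℝ) (T : ℕ) (Δ : ℝ) : ℝ :=
  C / Δ ^ (1 / (p - 1))
    + (6 * c) ^ (p / (p - 1)) / Δ ^ (1 / (p - 1)) *
        max (-pertInv μ (c ^ (p / (p - 1)) / (T * Δ ^ (p / (p - 1))))) 0 ^ (p / (p - 1))
    + (3 * c) ^ (p / (p - 1)) / Δ ^ (1 / (p - 1)) *
        max (pertInv μ (1 - c ^ (p / (p - 1)) / (T * Δ ^ (p / (p - 1))))) 0 ^ (p / (p - 1))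
    + Δ

end APE2

end

noncomputable section

namespace APE2

/-! ### The influence function -/

/-! The regret is the sum over suboptimal arms of the gap Δ times the expected number of choices, so
it suffices to count the choices of one such arm `a`. Put θ = r⋆ − Δ/3. A choice of `a` after n
earlier ones has one of four causes (`choice_indicator_le`): n is below a threshold; the estimate of
`a` exceeds r_a + Δ/3; the perturbation term of `a` is at least Δ/3; or no perturbed estimate
reaches θ.

Estimation errors: b_p is chosen so that exp(±ψ_p(x)) ≤ 1 ± x + b_p|x|^p. Hence, after centring,
products of exp(±ψ_p) over the choices of an arm form a supermartingale. The scale in the estimator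
depends on the current count, so there is one supermartingale for each n, stopped after n choices.
An arm is chosen with a given count at most once, so the exponential moment of error/β at count n,
summed over all rounds, is bounded uniformly in n and T (`sum_lintegral_expError_le`). The margin
supplies weights exp(-α n^(1-1/p)), whose sum has order α^(-p/(p-1)).

Fourth cause: given the history the perturbations are independent, so the probability that no arm
reaches θ is the odds F/(1-F) at the level of an optimal arm times the probability that only this
arm reaches θ; in that event it is chosen (`measure_all_lt_le`). The sum over rounds thus becomes a
sum over choices of the optimal arm. The hazard integral gives 1/(1-F) = O(e^x), which bounds the
odds by a left tail of F plus an exponential moment of the underestimation (`exists_odds_le`).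
Thresholds at quantiles of order 1/T make both tails cost a constant over T rounds. -/

lemma bConst_base_pos {p : ℝ} (hp1 : 1 < p) (hp2 : p ≤ 2) :
    0 < 2 * ((2 - p) / (p - 1)) ^ (1 - 2 / p) + ((2 - p) / (p - 1)) ^ (2 - 2 / p) := by
  rcases hp2.eq_or_lt with rfl | hp
  -- At p = 2 the ratio is 0, and 0^0 = 1 makes the base equal to 2.
  · norm_num
  · have h : 0 < (2 - p) / (p - 1) := div_pos (by linarith) (by linarith)
    positivity

lemma bConst_pos {p : ℝ} (hp1 : 1 < p) (hp2 : p ≤ 2) : 0 < bConst p :=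
  Real.rpow_pos_of_pos (bConst_base_pos hp1 hp2) _

/-- The base of the power in `bConst` is the minimum over `w > 0` of
`w ^ (2 - 2 / p) + 2 * w ^ (1 - 2 / p)`. -/
lemma bConst_base_le {p w : ℝ} (hp1 : 1 < p) (hp2 : p ≤ 2) (hw : 0 < w) :
    2 * ((2 - p) / (p - 1)) ^ (1 - 2 / p) + ((2 - p) / (p - 1)) ^ (2 - 2 / p) ≤
      w ^ (2 - 2 / p) + 2 * w ^ (1 - 2 / p) := by
  rcases hp2.eq_or_lt with rfl | hp
  · have : 0 ≤ w ^ (1 : ℝ) := by positivity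
    norm_num at this ⊢
    exact this
  · set v := (2 - p) / (p - 1) with hv
    have hv0 : 0 < v := div_pos (by linarith) (by linarith)
    -- Each power is convex in log w, hence lies above its tangent at log v.
    have hexp : ∀ r : ℝ, v ^ r * (1 + r * Real.log (w / v)) ≤ w ^ r := by
      intro r
      have h1 : w ^ r = v ^ r * (w / v) ^ r := by
        rw [← Real.mul_rpow hv0.le (by positivity)]
        congr 1
        field_simp
      rw [h1, Real.rpow_def_of_pos (div_pos hw hv0)]
      have := Real.add_one_le_exp (Real.log (w / v) * r)
      gcongr
      linarith
    have e1 := hexp (2 - 2 / p)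
    have e2 := hexp (1 - 2 / p)
    have hsplit : v ^ (2 - 2 / p) = v * v ^ (1 - 2 / p) := by
      rw [show 2 - 2 / p = 1 + (1 - 2 / p) by ring, Real.rpow_add hv0, Real.rpow_one]
    -- v is the critical point: the first-order terms of the two tangents cancel.
    have hz : v * (2 - 2 / p) + 2 * (1 - 2 / p) = 0 := by
      have : p - 1 ≠ 0 := by linarith
      have : p ≠ 0 := by linarith
      rw [hv]
      field_simp
      ring
    have key : v ^ (2 - 2 / p) * (1 + (2 - 2 / p) * Real.log (w / v)) +
        2 * (v ^ (1 - 2 / p) * (1 + (1 - 2 / p) * Real.log (w / v))) =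
        2 * v ^ (1 - 2 / p) + v ^ (2 - 2 / p) := by
      rw [hsplit]
      linear_combination v ^ (1 - 2 / p) * Real.log (w / v) * hz
    linarith

/-- Since b_p^(-2/p) is the minimal value in `bConst_base_le`, multiplying that bound by w^(2/p)
with w = b_p y^p suffices. The result is 1 ≤ (1 - y + w)(1 + y + w) in disguise, as needed for ψ_p
at negative arguments. -/
lemma sq_le_bConst {p y : ℝ} (hp1 : 1 < p) (hp2 : p ≤ 2) (hy : 0 < y) :
    y ^ 2 ≤ (bConst p * y ^ p) ^ 2 + 2 * (bConst p * y ^ p) := by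
  have hp0 : 0 < p := by linarith
  have hb := bConst_pos hp1 hp2
  set B := 2 * ((2 - p) / (p - 1)) ^ (1 - 2 / p) + ((2 - p) / (p - 1)) ^ (2 - 2 / p) with hB
  have hB0 : 0 < B := bConst_base_pos hp1 hp2
  set w := bConst p * y ^ p with hw
  have hw0 : 0 < w := by positivity
  have hy2 : y ^ 2 = w ^ (2 / p) * B := by
    rw [hw, Real.mul_rpow hb.le (by positivity), bConst, ← hB, ← Real.rpow_mul hB0.le,
      ← Real.rpow_mul hy.le, mul_div_cancel₀ _ hp0.ne',
      show -(p / 2) * (2 / p) = -1 by field_simp, Real.rpow_neg_one]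
    field_simp
    norm_cast
  have h := bConst_base_le hp1 hp2 hw0
  rw [← hB] at h
  calc y ^ 2 = w ^ (2 / p) * B := hy2
    _ ≤ w ^ (2 / p) * (w ^ (2 - 2 / p) + 2 * w ^ (1 - 2 / p)) := by gcongr
    _ = w ^ (2 / p + (2 - 2 / p)) + 2 * w ^ (2 / p + (1 - 2 / p)) := by
        rw [Real.rpow_add hw0, Real.rpow_add hw0]; ring
    _ = w ^ 2 + 2 * w := by
        rw [show 2 / p + (2 - 2 / p) = (2 : ℕ) by norm_num,
          show 2 / p + (1 - 2 / p) = 1 by ring, Real.rpow_natCast, Real.rpow_one]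

lemma influence_neg (p : ℝ) (x : ℝ) (hp : p ≠ 0) : influence p (-x) = -influence p x := by
  unfold influence
  rcases lt_trichotomy x 0 with h | h | h
  · rw [if_pos (by linarith), if_neg (by linarith), abs_neg, neg_neg, ← sub_eq_add_neg]
  · subst h
    simp [Real.zero_rpow hp]
  · rw [if_neg (by linarith), if_pos h.le, abs_neg, sub_neg_eq_add]

lemma exp_influence_le {p : ℝ} (hp1 : 1 < p) (hp2 : p ≤ 2) (x : ℝ) :
    Real.exp (influence p x) ≤ 1 + x + bConst p * |x| ^ p := by
  have hb := bConst_pos hp1 hp2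
  unfold influence
  split_ifs with h
  · rw [Real.exp_log (by positivity)]
    linarith
  · push Not at h
    have hy : 0 < |x| := abs_pos.2 h.ne
    have hx : x = -|x| := by rw [abs_of_neg h, neg_neg]
    have key := sq_le_bConst hp1 hp2 hy
    set y := |x|
    have hw : 0 < bConst p * y ^ p := by positivity
    set w := bConst p * y ^ p
    rw [Real.exp_neg, Real.exp_log (by linarith), inv_le_iff_one_le_mul₀ (by linarith), hx]
    nlinarith

lemma exp_sign_influence_le {p : ℝ} (hp1 : 1 < p) (hp2 : p ≤ 2) {σ : ℝ} (hσ : σ = 1 ∨ σ = -1)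
    (x : ℝ) : Real.exp (σ * influence p x) ≤ 1 + σ * x + bConst p * |x| ^ p := by
  rcases hσ with rfl | rfl
  · simpa using exp_influence_le hp1 hp2 x
  · have := exp_influence_le hp1 hp2 (-x)
    rw [influence_neg _ _ (by linarith), abs_neg] at this
    simpa using this

lemma measurable_influence (p : ℝ) : Measurable (influence p) := by
  unfold influence
  refine Measurable.ite measurableSet_Ici ?_ ?_ <;> fun_prop

/-! ### The perturbation -/

section perturbation

variable {μ : Measure ℝ} [IsProbabilityMeasure μ]

lemma pertCDF_nonneg (μ : Measure ℝ) (x : ℝ) : 0 ≤ pertCDF μ x := measureReal_nonneg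

lemma pertCDF_le_one (x : ℝ) : pertCDF μ x ≤ 1 := measureReal_le_one

lemma pertCDF_mono : Monotone (pertCDF μ) := fun _ _ h =>
  measureReal_mono (Set.Iio_subset_Iio h)

lemma one_sub_pertCDF (x : ℝ) : 1 - pertCDF μ x = μ.real (Set.Ici x) := by
  rw [pertCDF, ← probReal_compl_eq_one_sub measurableSet_Iio, Set.compl_Iio]

lemma cdf_le_pertCDF {x y : ℝ} (h : x < y) : cdf μ x ≤ pertCDF μ y := by
  rw [cdf_eq_real]
  exact measureReal_mono fun z hz => lt_of_le_of_lt hz h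

lemma pertCDF_le_cdf (x : ℝ) : pertCDF μ x ≤ cdf μ x := by
  rw [cdf_eq_real]
  exact measureReal_mono fun z hz => le_of_lt (Set.mem_Iio.1 hz)

lemma exists_le_pertCDF {y : ℝ} (hy : y < 1) : ∃ x, y ≤ pertCDF μ x := by
  obtain ⟨x, hx⟩ := ((tendsto_cdf_atTop μ).eventually (lt_mem_nhds hy)).exists
  exact ⟨x + 1, hx.le.trans (cdf_le_pertCDF (by linarith))⟩

lemma exists_pertCDF_lt {y : ℝ} (hy : 0 < y) : ∃ x, pertCDF μ x < y := by
  obtain ⟨x, hx⟩ := ((tendsto_cdf_atBot μ).eventually (gt_mem_nhds hy)).exists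
  exact ⟨x, (pertCDF_le_cdf x).trans_lt hx⟩

/-- Strictly below the quantile of order `y`, the distribution function is at most `y`. -/
lemma pertCDF_le_of_lt_pertInv {x y : ℝ} (hy : 0 < y) (hx : x < pertInv μ y) :
    pertCDF μ x ≤ y := by
  have hbdd : BddBelow {x : ℝ | y ≤ pertCDF μ x} := by
    obtain ⟨z, hz⟩ := exists_pertCDF_lt (μ := μ) hy
    refine ⟨z, fun w hw => ?_⟩
    by_contra! hlt
    exact absurd (hw.trans (pertCDF_mono hlt.le)) (not_le.2 hz)
  -- Only boundedness below is needed, so y ≥ 1 (possibly an empty set) is covered; the final choice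
  -- of y may exceed 1.
  have := notMem_of_lt_csInf hx hbdd
  simp only [Set.mem_ofPred_eq, not_le] at this
  exact this.le

/-- Strictly above the quantile of order `y`, the distribution function is at least `y`. -/
lemma le_pertCDF_of_pertInv_lt {x y : ℝ} (hy : y < 1) (hx : pertInv μ y < x) :
    y ≤ pertCDF μ x := by
  -- Only nonemptiness is needed, so y ≤ 0 with its default infimum 0 is covered.
  obtain ⟨z, hz, hzx⟩ := exists_lt_of_csInf_lt (exists_le_pertCDF (μ := μ) hy) hx
  exact le_trans hz (pertCDF_mono hzx.le)

/-- The survival function of the perturbation decays at most like `exp (-x)`. -/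
lemma exists_inv_survival_le (hμ : PerturbationAssumption μ) :
    ∃ C : ℝ, 0 < C ∧ ∀ x, (1 - pertCDF μ x)⁻¹ ≤ C * Real.exp (max x 0) := by
  obtain ⟨CF, hCF⟩ := hμ.hazard_integral
  set F := pertCDF μ with hF
  have hpos : ∀ x, 0 < 1 - F x := fun x => sub_pos.2 (hμ.unbounded x)
  set u : ℝ → ℝ := fun x => (1 - F x)⁻¹ with hu
  have hu0 : ∀ x, 0 < u x := fun x => inv_pos.2 (hpos x)
  have humono : Monotone u := fun x y hxy =>
    inv_anti₀ (hpos y) (sub_le_sub_left (pertCDF_mono hxy) 1)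
  obtain ⟨ε, hε0, hε⟩ : ∃ ε, 0 < ε ∧ 0 < F ε := by
    obtain ⟨x, hx⟩ := exists_le_pertCDF (μ := μ) (show (1 / 2 : ℝ) < 1 by norm_num)
    exact ⟨max x 1, by positivity,
      lt_of_lt_of_le (by norm_num) (hx.trans (pertCDF_mono (le_max_left _ _)))⟩
  have hFpos : ∀ x, ε ≤ x → 0 < F x := fun x hx => hε.trans_le (pertCDF_mono hx)
  have hconc : ConcaveOn ℝ (Set.Ioi ε) (fun x => Real.log (F x)) := by
    refine ⟨convex_Ioi ε, fun x hx y hy s r hs hr hsr => ?_⟩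
    have hx' := hFpos x (le_of_lt hx)
    have hy' := hFpos y (le_of_lt hy)
    rcases hs.eq_or_lt with rfl | hs
    · have : r = 1 := by linarith
      simp [this]
    rcases hr.eq_or_lt with rfl | hr
    · have : s = 1 := by linarith
      simp [this]
    have hr1 : r = 1 - s := by linarith
    subst hr1
    have h := hμ.logConcave x y s hs (by linarith)
    have h2 := Real.log_le_log (by positivity) h
    rw [Real.log_mul (by positivity) (by positivity), Real.log_rpow hx', Real.log_rpow hy'] at h2
    simpa using h2
  -- Where u is differentiable, u' = h/(1-F). Hence u(x) - u(2ε) = ∫ u' ≤ e^x ∫ h(z) e^(-z)/(1-F(z))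
  -- dz. Absolute continuity of u comes from log-concavity: log F is concave on (ε, ∞), hence
  -- Lipschitz on the compact [2ε, x].
  have hmain : ∀ x, 2 * ε ≤ x → u x ≤ u (2 * ε) + Real.exp x * CF := by
    intro x hx
    obtain ⟨L, hL⟩ := ((hconc.locallyLipschitzOn isOpen_Ioi).mono
      (show Set.Icc (2 * ε) x ⊆ Set.Ioi ε from fun z hz => by
        have := hz.1
        simp only [Set.mem_Ioi]; linarith)).exists_lipschitzOnWith_of_compact isCompact_Icc
    have hFlip : ∀ a ∈ Set.Icc (2 * ε) x, ∀ b ∈ Set.Icc (2 * ε) x, a ≤ b →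
        F b - F a ≤ L * (b - a) := by
      intro a ha b hb hab
      have h1 := hL.dist_le_mul b hb a ha
      rw [Real.dist_eq, Real.dist_eq, abs_of_nonneg (sub_nonneg.2 hab)] at h1
      have ha' := hFpos a (by linarith [ha.1])
      have hb' := hFpos b (by linarith [hb.1])
      have h2 := le_abs_self (Real.log (F b) - Real.log (F a))
      -- As F ≤ 1, increments of F are at most those of log F.
      have h3 : F b - F a ≤ Real.log (F b) - Real.log (F a) := by
        have h4 := Real.add_one_le_exp (Real.log (F a) - Real.log (F b))
        rw [Real.exp_sub, Real.exp_log ha', Real.exp_log hb', le_div_iff₀ hb'] at h4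
        have h5 : 0 ≤ Real.log (F b) - Real.log (F a) :=
          sub_nonneg.2 (Real.log_le_log ha' (pertCDF_mono hab))
        have h6 : F b ≤ 1 := pertCDF_le_one b
        nlinarith
      linarith
    have hulip : LipschitzOnWith (Real.toNNReal (L * (u x * u x))) u (Set.uIcc (2 * ε) x) := by
      rw [Set.uIcc_of_le hx]
      refine LipschitzOnWith.of_dist_le_mul ?_
      have : ∀ a ∈ Set.Icc (2 * ε) x, ∀ b ∈ Set.Icc (2 * ε) x, a ≤ b →
          u b - u a ≤ L * (u x * u x) * (b - a) := by
        intro a ha b hb hab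
        have h1 : u b - u a = (F b - F a) * (u a * u b) := by
          simp only [hu]
          have := (hpos a).ne'
          have := (hpos b).ne'
          field_simp
          ring
        rw [h1]
        have h2 := hFlip a ha b hb hab
        have h3 : u a * u b ≤ u x * u x :=
          mul_le_mul (humono ha.2) (humono hb.2) (hu0 b).le (hu0 x).le
        have h4 : 0 ≤ F b - F a := sub_nonneg.2 (pertCDF_mono hab)
        calc (F b - F a) * (u a * u b) ≤ (L * (b - a)) * (u x * u x) :=
              mul_le_mul h2 h3 (mul_pos (hu0 a) (hu0 b)).le (h4.trans h2)
          _ = _ := by ring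
      intro a ha b hb
      rw [Real.coe_toNNReal _ (mul_nonneg L.coe_nonneg (mul_pos (hu0 x) (hu0 x)).le), Real.dist_eq,
        Real.dist_eq]
      rcases le_total a b with h | h
      · rw [abs_sub_comm, abs_of_nonneg (sub_nonneg.2 (humono h)), abs_sub_comm,
          abs_of_nonneg (sub_nonneg.2 h)]
        exact this a ha b hb h
      · rw [abs_of_nonneg (sub_nonneg.2 (humono h)), abs_of_nonneg (sub_nonneg.2 h)]
        exact this b hb a ha h
    have hac := hulip.absolutelyContinuousOnInterval
    have hint := hac.intervalIntegrable_deriv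
    have heq := hac.integral_deriv_eq_sub
    have hderiv : ∀ z, 0 ≤ deriv u z := fun z => humono.deriv_nonneg
    rw [intervalIntegral.integral_of_le hx,
      integral_eq_lintegral_of_nonneg_ae (Filter.Eventually.of_forall hderiv)
        ((intervalIntegrable_iff_integrableOn_Ioc_of_le hx).1 hint).1] at heq
    have hlint : ∫⁻ z in Set.Ioc (2 * ε) x, ENNReal.ofReal (deriv u z) ≤
        ENNReal.ofReal (Real.exp x) * CF := by
      calc ∫⁻ z in Set.Ioc (2 * ε) x, ENNReal.ofReal (deriv u z)
          ≤ ∫⁻ z in Set.Ioc (2 * ε) x, ENNReal.ofReal (Real.exp x) *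
              ENNReal.ofReal (hazard μ z * Real.exp (-z) / (1 - F z)) := by
            refine setLIntegral_mono' measurableSet_Ioc fun z hz => ?_
            by_cases hd : DifferentiableAt ℝ u z
            · rw [← ENNReal.ofReal_mul (Real.exp_pos x).le]
              apply ENNReal.ofReal_le_ofReal
              have h1 : hazard μ z = deriv u z / u z := by
                unfold hazard
                exact deriv.log hd (hu0 z).ne'
              have h2 : Real.exp x * (hazard μ z * Real.exp (-z) / (1 - F z)) =
                  deriv u z * Real.exp (x - z) := by
                rw [h1, show x - z = x + -z from sub_eq_add_neg _ _, Real.exp_add]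
                simp only [hu]
                have := (hpos z).ne'
                field_simp
              rw [h2]
              exact le_mul_of_one_le_right (hderiv z)
                (Real.one_le_exp (sub_nonneg.2 hz.2))
            -- The default value 0 of `deriv` makes exceptional points harmless.
            · rw [deriv_zero_of_not_differentiableAt hd, ENNReal.ofReal_zero]
              exact zero_le
        _ = ENNReal.ofReal (Real.exp x) * ∫⁻ z in Set.Ioc (2 * ε) x,
              ENNReal.ofReal (hazard μ z * Real.exp (-z) / (1 - F z)) :=
            lintegral_const_mul' _ _ ENNReal.ofReal_ne_top
        _ ≤ ENNReal.ofReal (Real.exp x) * CF := by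
            gcongr
            refine le_trans (lintegral_mono_set ?_) hCF
            intro z hz
            have := hz.1
            simp only [Set.mem_Ioi]
            linarith
    have hfin := ENNReal.toReal_mono (by finiteness) hlint
    rw [heq, ENNReal.toReal_mul, ENNReal.toReal_ofReal (Real.exp_pos x).le,
      ENNReal.coe_toReal] at hfin
    linarith
  refine ⟨u (2 * ε) + CF, add_pos_of_pos_of_nonneg (hu0 _) CF.coe_nonneg, fun x => ?_⟩
  change u x ≤ _
  have h1 : 1 ≤ Real.exp (max x 0) := Real.one_le_exp (le_max_right _ _)
  rcases le_total (2 * ε) x with hx | hx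
  · have h2 := hmain x hx
    rw [max_eq_left (by linarith)] at h1 ⊢
    nlinarith [hu0 (2 * ε)]
  · have h2 := humono hx
    have h3 : (0 : ℝ) ≤ CF := CF.coe_nonneg
    nlinarith [hu0 (2 * ε)]

/-- The odds `F / (1 - F)` at `x - m` split into a left tail at `-m / 2` and an exponential. -/
lemma exists_odds_le (hμ : PerturbationAssumption μ) :
    ∃ C : ℝ, 0 < C ∧ ∀ x m, 0 ≤ m →
      pertCDF μ (x - m) / (1 - pertCDF μ (x - m)) ≤
        2 * pertCDF μ (-m / 2) + C * Real.exp (x - m / 2) := by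
  obtain ⟨C, hC, h⟩ := exists_inv_survival_le hμ
  refine ⟨C, hC, fun x m hm => ?_⟩
  have hpos := sub_pos.2 (hμ.unbounded (x - m))
  have hF0 := pertCDF_nonneg μ (x - m)
  -- For x ≤ m/2 the argument is at most -m/2 ≤ 0, where 1 - F ≥ 1/2. For x > m/2 both x - m and 0
  -- are below x - m/2, so the bound on 1/(1-F) applies.
  rcases le_or_gt x (m / 2) with hx | hx
  · have h1 : pertCDF μ (x - m) ≤ pertCDF μ (-m / 2) := pertCDF_mono (by linarith)
    have h2 : pertCDF μ (x - m) ≤ 1 / 2 := (pertCDF_mono (by linarith)).trans hμ.half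
    have h3 : pertCDF μ (x - m) / (1 - pertCDF μ (x - m)) ≤ 2 * pertCDF μ (x - m) := by
      rw [div_le_iff₀ hpos]
      nlinarith
    have : 0 ≤ C * Real.exp (x - m / 2) := by positivity
    linarith
  · have h1 : pertCDF μ (x - m) / (1 - pertCDF μ (x - m)) ≤ (1 - pertCDF μ (x - m))⁻¹ := by
      rw [div_eq_mul_inv]
      exact mul_le_of_le_one_left (inv_pos.2 hpos).le (pertCDF_le_one _)
    have h2 : max (x - m) 0 ≤ x - m / 2 := max_le (by linarith) (by linarith)
    have h3 : C * Real.exp (max (x - m) 0) ≤ C * Real.exp (x - m / 2) := by gcongr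
    have := h (x - m)
    have := pertCDF_nonneg μ (-m / 2)
    linarith

end perturbation

/-! ### Counting -/

section counting

/-- Comparison of a decreasing summand with its integral over (0, ∞), a Gamma integral. -/
lemma sum_exp_neg_mul_rpow_le {e α : ℝ} (he : 0 < e) (hα : 0 < α) (N : ℕ) :
    ∑ n ∈ Finset.range N, Real.exp (-α * ((n + 1 : ℕ) : ℝ) ^ e) ≤
      Real.Gamma (1 / e + 1) * α ^ (-1 / e) := by
  have hanti : AntitoneOn (fun x : ℝ => Real.exp (-α * x ^ e)) (Set.Ici 0) := by
    intro x hx y hy hxy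
    have : x ^ e ≤ y ^ e := Real.rpow_le_rpow hx hxy he.le
    apply Real.exp_le_exp.2
    nlinarith
  have hval := integral_exp_neg_mul_rpow he hα
  have hint : IntegrableOn (fun x : ℝ => Real.exp (-α * x ^ e)) (Set.Ioi 0) := by
    -- A non-integrable function would have integral 0, but the known value is positive.
    by_contra hcon
    rw [integral_undef hcon] at hval
    have : 0 < α ^ (-1 / e) * Real.Gamma (1 / e + 1) :=
      mul_pos (Real.rpow_pos_of_pos hα _) (Real.Gamma_pos_of_pos (by positivity))
    linarith
  have h := (hanti.mono (show Set.Icc (0 : ℝ) (0 + N) ⊆ Set.Ici 0 from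
    fun x hx => hx.1)).sum_le_integral
  simp only [zero_add] at h
  refine h.trans ?_
  rw [intervalIntegral.integral_of_le (by positivity), mul_comm, ← hval]
  exact setIntegral_mono_set hint (Filter.Eventually.of_forall fun x => (Real.exp_pos _).le)
    (Filter.Eventually.of_forall fun x hx => hx.1)

variable {K : ℕ} (act : ℕ → Fin K)

lemma pulls_zero (a : Fin K) : pulls act 0 a = 0 := by simp [pulls]

lemma pulls_succ (t : ℕ) (a : Fin K) :
    pulls act (t + 1) a = pulls act t a + if act t = a then 1 else 0 := by
  unfold pulls
  rw [Finset.range_add_one, Finset.filter_insert]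
  split_ifs with h
  · rw [Finset.card_insert_of_notMem (by simp)]
  · simp

lemma pulls_mono (a : Fin K) : Monotone fun t => pulls act t a :=
  monotone_nat_of_le_succ fun t => by rw [pulls_succ]; exact Nat.le_add_right _ _

lemma pulls_le (t : ℕ) (a : Fin K) : pulls act t a ≤ t := by
  simpa [pulls] using Finset.card_filter_le (Finset.range t) fun s => act s = a

lemma pulls_lt_of_lt {s t : ℕ} {a : Fin K} (h : act s = a) (hst : s < t) :
    pulls act s a < pulls act t a := by
  have h1 := pulls_mono act a (show s + 1 ≤ t from hst)
  simp only [pulls_succ, h, if_true] at h1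
  omega

/-- Summing over the rounds in which `a` is chosen is summing over its numbers of earlier
choices. -/
lemma sum_pulls {M : Type*} [AddCommMonoid M] (f : ℕ → M) (T : ℕ) (a : Fin K) :
    ∑ t ∈ Finset.range T, (if act t = a then f (pulls act t a) else 0) =
      ∑ n ∈ Finset.range (pulls act T a), f n := by
  induction T with
  | zero => simp [pulls_zero]
  | succ T ih =>
    rw [Finset.sum_range_succ, ih, pulls_succ]
    split_ifs with h
    · rw [Finset.sum_range_succ]
    · simp

lemma one_le_pulls {t : ℕ} (ht : K ≤ t) (hinit : ∀ (s : ℕ) (hs : s < K), act s = ⟨s, hs⟩)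
    (a : Fin K) : 1 ≤ pulls act t a := by
  have h : act a = a := hinit a a.2
  have := pulls_lt_of_lt act h (lt_of_lt_of_le a.2 ht)
  omega

end counting

/-! ### Measurability with respect to the history -/

section measurability

variable {Ω : Type*} {K : ℕ} {A : ℕ → Ω → Fin K} {R : ℕ → Ω → Fin K → ℝ}

lemma measurable_history_pair {s t : ℕ} (h : s < t) :
    Measurable[history A R t] (fun ω => (A s ω, R s ω (A s ω))) :=
  measurable_iff_comap_le.2 (le_iSup₂_of_le s (Finset.mem_range.2 h) le_rfl)

lemma measurable_history_act {s t : ℕ} (h : s < t) : Measurable[history A R t] (A s) :=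
  measurable_fst.comp (measurable_history_pair h)

lemma measurable_history_rew {s t : ℕ} (h : s < t) :
    Measurable[history A R t] (fun ω => R s ω (A s ω)) :=
  measurable_snd.comp (measurable_history_pair h)

lemma history_le [mΩ : MeasurableSpace Ω] (hA : ∀ t, Measurable (A t))
    (hR : ∀ t, Measurable (R t)) (t : ℕ) : history A R t ≤ mΩ := by
  refine iSup₂_le fun s _ => measurable_iff_comap_le.1 ((hA s).prodMk ?_)
  have h : Measurable fun q : (Fin K → ℝ) × Fin K => q.1 q.2 :=
    measurable_from_prod_countable_left fun a => measurable_pi_apply a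
  exact h.comp ((hR s).prodMk (hA s))

lemma pulls_eq_sum (act : ℕ → Fin K) (t : ℕ) (a : Fin K) :
    pulls act t a = ∑ s ∈ Finset.range t, if act s = a then 1 else 0 :=
  Finset.card_filter _ _

lemma measurable_history_pulls {s t : ℕ} (h : s ≤ t) (a : Fin K) :
    Measurable[history A R t] (fun ω => pulls (fun s => A s ω) s a) := by
  simp only [pulls_eq_sum]
  refine Finset.measurable_sum _ fun r hr => ?_
  exact Measurable.ite (measurable_history_act ((Finset.mem_range.1 hr).trans_le h)
    (measurableSet_singleton a)) measurable_const measurable_const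

lemma measurable_history_estimate (p c : ℝ) (t : ℕ) (a : Fin K) :
    Measurable[history A R t]
      (fun ω => estimate p c (fun s => A s ω) (fun s => R s ω) t a) := by
  have hp : Measurable[history A R t] (fun ω => (pulls (fun s => A s ω) t a : ℝ)) :=
    measurable_from_nat.comp (measurable_history_pulls le_rfl a)
  -- The history contains only received rewards, so `R s ω a` is rewritten as `R s ω (A s ω)`.
  have heq : (fun ω => estimate p c (fun s => A s ω) (fun s => R s ω) t a) = fun ω =>
      c / (pulls (fun s => A s ω) t a : ℝ) ^ (1 - 1 / p) *
        ∑ s ∈ Finset.range t, if A s ω = a then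
          influence p (R s ω (A s ω) / (c * (pulls (fun s => A s ω) t a : ℝ) ^ (1 / p))) else 0 := by
    ext ω
    rw [estimate, Finset.sum_filter]
    congr 1
    refine Finset.sum_congr rfl fun s _ => ?_
    split_ifs with h
    · rw [h]
    · rfl
  rw [heq]
  refine (measurable_const.div (hp.pow_const _)).mul (Finset.measurable_sum _ fun s hs => ?_)
  have hs' := Finset.mem_range.1 hs
  exact Measurable.ite (measurable_history_act hs' (measurableSet_singleton a))
    ((measurable_influence p).comp ((measurable_history_rew hs').div
      (measurable_const.mul (hp.pow_const _)))) measurable_const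

end measurability

/-! ### Concentration of the estimator -/

section concentration

/-- What is known when the reward of round `t` is drawn: the history, the perturbations and the
choice. -/
@[reducible] def choiceInfo {Ω : Type*} {K : ℕ} (A : ℕ → Ω → Fin K) (R G : ℕ → Ω → Fin K → ℝ)
    (t : ℕ) : MeasurableSpace Ω :=
  history A R t ⊔ MeasurableSpace.comap (fun ω => (G t ω, A t ω)) inferInstance

/-- The exponent of the supermartingale, stopped once arm `a` has been chosen `n` times. -/
def stoppedExponent {K : ℕ} (p c σ κ : ℝ) (n : ℕ) (act : ℕ → Fin K) (rew : ℕ → Fin K → ℝ)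
    (a : Fin K) (t : ℕ) : ℝ :=
  ∑ s ∈ Finset.range t, if act s = a ∧ pulls act s a < n then
    σ * influence p (rew s (act s) / (c * (n : ℝ) ^ (1 / p))) - κ else 0

lemma integrable_of_lintegral_rpow_le {p : ℝ} (hp : 1 < p) {νp : ℝ≥0} {D : Measure ℝ}
    [IsProbabilityMeasure D] (hD : ∫⁻ x, ENNReal.ofReal (|x| ^ p) ∂D ≤ νp) :
    Integrable (fun x => |x| ^ p) D ∧ ∫ x, |x| ^ p ∂D ≤ νp ∧ Integrable (fun x => x) D := by
  have hp0 : 0 < p := by linarith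
  have hmeas : Measurable fun x : ℝ => |x| ^ p := by fun_prop
  have hnn : ∀ x : ℝ, 0 ≤ |x| ^ p := fun x => by positivity
  have h1 : Integrable (fun x : ℝ => |x| ^ p) D :=
    ⟨hmeas.aestronglyMeasurable, by
      rw [hasFiniteIntegral_iff_ofReal (Filter.Eventually.of_forall hnn)]
      exact hD.trans_lt ENNReal.coe_lt_top⟩
  refine ⟨h1, ?_, ?_⟩
  · rw [integral_eq_lintegral_of_nonneg_ae (Filter.Eventually.of_forall hnn)
      hmeas.aestronglyMeasurable]
    simpa using ENNReal.toReal_mono ENNReal.coe_ne_top hD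
  · refine Integrable.mono' ((integrable_const (1 : ℝ)).add h1) (by fun_prop)
      (Filter.Eventually.of_forall fun x => ?_)
    simp only [Pi.add_apply, Real.norm_eq_abs]
    rcases le_total |x| 1 with h | h
    · linarith [hnn x]
    · have := Real.rpow_le_rpow_of_exponent_le h hp.le
      rw [Real.rpow_one] at this
      linarith

/-- Integrating the polynomial bound gives 1 + σr/s + b_p E|x|^p/s^p, at most the exponential of the
compensator by 1 + κ ≤ e^κ. -/
lemma lintegral_exp_influence_le {p s : ℝ} (hp1 : 1 < p) (hp2 : p ≤ 2) (hs : 0 < s) {νp : ℝ≥0}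
    {D : Measure ℝ} [IsProbabilityMeasure D] (hD : ∫⁻ x, ENNReal.ofReal (|x| ^ p) ∂D ≤ νp)
    {σ : ℝ} (hσ : σ = 1 ∨ σ = -1) :
    ∫⁻ x, ENNReal.ofReal (Real.exp (σ * influence p (x / s) -
      (bConst p * νp / s ^ p + σ * (∫ x, x ∂D) / s))) ∂D ≤ 1 := by
  obtain ⟨h1, h2, h3⟩ := integrable_of_lintegral_rpow_le hp1 hD
  have hb := bConst_pos hp1 hp2
  set κ := bConst p * νp / s ^ p + σ * (∫ x, x ∂D) / s with hκ
  set g : ℝ → ℝ := fun x => 1 + (σ / s) * x + (bConst p / s ^ p) * |x| ^ p with hg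
  have hle : ∀ x, Real.exp (σ * influence p (x / s)) ≤ g x := by
    intro x
    have := exp_sign_influence_le hp1 hp2 hσ (x / s)
    rw [abs_div, abs_of_pos hs, Real.div_rpow (abs_nonneg x) hs.le] at this
    refine this.trans (le_of_eq ?_)
    simp only [hg]
    ring
  have hgint : Integrable g D := ((integrable_const 1).add (h3.const_mul _)).add (h1.const_mul _)
  have hgval : ∫ x, g x ∂D ≤ Real.exp κ := by
    have : ∫ x, g x ∂D = 1 + (σ / s) * (∫ x, x ∂D) + (bConst p / s ^ p) * ∫ x, |x| ^ p ∂D := by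
      simp only [hg]
      have h4 : Integrable (fun x => 1 + (σ / s) * x) D :=
        (integrable_const 1).add (h3.const_mul _)
      rw [integral_add h4 (h1.const_mul _), integral_add (integrable_const 1) (h3.const_mul _),
        integral_const_mul, integral_const_mul]
      simp
    rw [this]
    have h4 : (bConst p / s ^ p) * ∫ x, |x| ^ p ∂D ≤ (bConst p / s ^ p) * νp := by gcongr
    have h5 := Real.add_one_le_exp κ
    have h6 : κ = (bConst p / s ^ p) * νp + (σ / s) * (∫ x, x ∂D) := by rw [hκ]; ring
    linarith
  calc ∫⁻ x, ENNReal.ofReal (Real.exp (σ * influence p (x / s) - κ)) ∂D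
      ≤ ∫⁻ x, ENNReal.ofReal (Real.exp (-κ)) * ENNReal.ofReal (g x) ∂D := by
        refine lintegral_mono fun x => ?_
        rw [← ENNReal.ofReal_mul (Real.exp_pos _).le]
        apply ENNReal.ofReal_le_ofReal
        rw [sub_eq_neg_add, Real.exp_add]
        gcongr
        exact hle x
    _ = ENNReal.ofReal (Real.exp (-κ)) * ENNReal.ofReal (∫ x, g x ∂D) := by
        rw [lintegral_const_mul' _ _ ENNReal.ofReal_ne_top,
          ofReal_integral_eq_lintegral_ofReal hgint
            (Filter.Eventually.of_forall fun x => (Real.exp_pos _).le.trans (hle x))]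
    _ ≤ ENNReal.ofReal (Real.exp (-κ)) * ENNReal.ofReal (Real.exp κ) := by gcongr
    _ = 1 := by
        rw [← ENNReal.ofReal_mul (Real.exp_pos _).le, ← Real.exp_add]
        simp

lemma measurable_history_stoppedExponent {Ω : Type*} {K : ℕ} {p c : ℝ} {R : ℕ → Ω → Fin K → ℝ}
    {A : ℕ → Ω → Fin K} (σ κ : ℝ) (n : ℕ) (a : Fin K) (t : ℕ) :
    Measurable[history A R t]
      (fun ω => stoppedExponent p c σ κ n (fun s => A s ω) (fun s => R s ω) a t) := by
  refine Finset.measurable_sum _ fun s hs => ?_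
  have hs' := Finset.mem_range.1 hs
  refine Measurable.ite ?_ ?_ measurable_const
  · exact MeasurableSet.inter (measurable_history_act hs' (measurableSet_singleton a))
      (measurable_history_pulls hs'.le a measurableSet_Iio)
  · exact (((measurable_influence p).comp ((measurable_history_rew hs').div_const _)).const_mul
      σ).sub_const κ

/-- One supermartingale step: on the known event `E` an independent factor of mean at most 1 enters;
off `E` the process stands still. -/
lemma lintegral_indicator_mul_add_le {Ω : Type*} {m m' mΩ : MeasurableSpace Ω} {P : Measure Ω}
    (hm : m ≤ mΩ) (hm' : m' ≤ mΩ) (hind : Indep m m' P) {L Y : Ω → ℝ≥0∞} {E : Set Ω}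
    (hL : Measurable[m] L) (hE : MeasurableSet[m] E) (hY : Measurable[m'] Y)
    (hYint : ∫⁻ ω, Y ω ∂P ≤ 1) :
    ∫⁻ ω, (E.indicator L ω * Y ω + Eᶜ.indicator L ω) ∂P ≤ ∫⁻ ω, L ω ∂P := by
  have hLE : Measurable[m] (E.indicator L) := hL.indicator hE
  have hprod : Measurable fun ω => E.indicator L ω * Y ω :=
    (hLE.mono hm le_rfl).mul (hY.mono hm' le_rfl)
  rw [lintegral_add_left hprod,
    lintegral_mul_eq_lintegral_mul_lintegral_of_independent_measurableSpace hm hm' hind hLE hY]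
  calc (∫⁻ ω, E.indicator L ω ∂P) * (∫⁻ ω, Y ω ∂P) + ∫⁻ ω, Eᶜ.indicator L ω ∂P
      ≤ (∫⁻ ω, E.indicator L ω ∂P) * 1 + ∫⁻ ω, Eᶜ.indicator L ω ∂P := by gcongr
    _ = ∫⁻ ω, L ω ∂P := by
      rw [mul_one, lintegral_indicator (hm _ hE), lintegral_indicator (hm _ hE).compl,
        lintegral_add_compl _ (hm _ hE)]

variable {Ω : Type*} [mΩ : MeasurableSpace Ω] {P : Measure Ω} {K : ℕ} {p c : ℝ}
  {D : Fin K → Measure ℝ} {μ : Measure ℝ} {R G : ℕ → Ω → Fin K → ℝ} {A : ℕ → Ω → Fin K} {νp : ℝ≥0}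

/-- With n fixed in advance, the scale c n^(1/p) is deterministic from the start. Whether round t
counts is decided by `choiceInfo`, of which the reward is independent, so each round is a
supermartingale step. -/
lemma lintegral_exp_stoppedExponent_le [IsProbabilityMeasure P] [∀ a, IsProbabilityMeasure (D a)]
    (hrun : IsRun P p c D μ R G A) (hp1 : 1 < p) (hp2 : p ≤ 2)
    (hc : 0 < c) (hD : ∀ a, ∫⁻ x, ENNReal.ofReal (|x| ^ p) ∂(D a) ≤ νp)
    {σ : ℝ} (hσ : σ = 1 ∨ σ = -1) {n : ℕ} (hn : 1 ≤ n) (a : Fin K) {κ : ℝ}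
    (hκ : κ = bConst p * νp / (c * (n : ℝ) ^ (1 / p)) ^ p +
      σ * meanReward D a / (c * (n : ℝ) ^ (1 / p))) (t : ℕ) :
    ∫⁻ ω, ENNReal.ofReal (Real.exp
      (stoppedExponent p c σ κ n (fun s => A s ω) (fun s => R s ω) a t)) ∂P ≤ 1 := by
  have hs : 0 < c * (n : ℝ) ^ (1 / p) := by
    have : (0 : ℝ) < n := by exact_mod_cast hn
    positivity
  set s := c * (n : ℝ) ^ (1 / p) with hsdef
  have hhist := history_le hrun.measurable_A hrun.measurable_R
  induction t with
  | zero => simp [stoppedExponent]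
  | succ t ih =>
    refine le_trans ?_ ih
    set L : Ω → ℝ≥0∞ := fun ω => ENNReal.ofReal (Real.exp
      (stoppedExponent p c σ κ n (fun s => A s ω) (fun s => R s ω) a t)) with hL
    set E : Set Ω := {ω | A t ω = a ∧ pulls (fun s => A s ω) t a < n} with hE
    set Y : Ω → ℝ≥0∞ := fun ω =>
      ENNReal.ofReal (Real.exp (σ * influence p (R t ω a / s) - κ)) with hY
    have hmle : choiceInfo A R G t ≤ mΩ := sup_le (hhist t) (measurable_iff_comap_le.1
      ((hrun.measurable_G t).prodMk (hrun.measurable_A t)))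
    have hLm : Measurable[choiceInfo A R G t] L :=
      (((measurable_history_stoppedExponent σ κ n a t).exp).ennreal_ofReal).mono
        le_sup_left le_rfl
    have hAm : Measurable[choiceInfo A R G t] (A t) := by
      have h1 : Measurable[MeasurableSpace.comap (fun ω => (G t ω, A t ω)) inferInstance]
          (fun ω => (G t ω, A t ω)) := comap_measurable _
      exact (measurable_snd.comp h1).mono le_sup_right le_rfl
    have hEm : MeasurableSet[choiceInfo A R G t] E :=
      MeasurableSet.inter (hAm (measurableSet_singleton a))
        (((measurable_history_pulls le_rfl a).mono le_sup_left le_rfl) measurableSet_Iio)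
    have hYm : Measurable[MeasurableSpace.comap (R t) inferInstance] Y := by
      have h1 : Measurable[MeasurableSpace.comap (R t) inferInstance] (R t) := comap_measurable _
      have h2 : Measurable fun x : ℝ =>
          ENNReal.ofReal (Real.exp (σ * influence p (x / s) - κ)) :=
        (((((measurable_influence p).comp (measurable_id.div_const s)).const_mul σ).sub_const
          κ).exp).ennreal_ofReal
      exact h2.comp ((measurable_pi_apply a).comp h1)
    have hYint : ∫⁻ ω, Y ω ∂P ≤ 1 := by
      have h := lintegral_exp_influence_le hp1 hp2 hs (hD a) hσ
      rw [← hrun.law_R t a] at h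
      rw [lintegral_map] at h
      · refine le_trans (le_of_eq ?_) h
        simp only [hY]
        rw [hrun.law_R t a, hκ]
        rfl
      · refine (((((measurable_influence p).comp (measurable_id.div_const s)).const_mul
          σ).sub_const _).exp).ennreal_ofReal
      · exact (measurable_pi_apply a).comp (hrun.measurable_R t)
    have hstep : ∀ ω, ENNReal.ofReal (Real.exp
        (stoppedExponent p c σ κ n (fun s => A s ω) (fun s => R s ω) a (t + 1))) =
        E.indicator L ω * Y ω + Eᶜ.indicator L ω := by
      intro ω
      rw [stoppedExponent, Finset.sum_range_succ, ← stoppedExponent]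
      by_cases hω : ω ∈ E
      · have h1 : A t ω = a := hω.1
        have h2 : pulls (fun s => A s ω) t a < n := hω.2
        rw [if_pos ⟨h1, h2⟩, Set.indicator_of_mem hω, Set.indicator_of_notMem (by simpa using hω),
          add_zero, Real.exp_add, ENNReal.ofReal_mul (Real.exp_pos _).le]
        simp only [h1, hL, hY, hsdef]
      · rw [if_neg (by exact hω), Set.indicator_of_notMem hω, Set.indicator_of_mem hω]
        simp [hL]
    simp_rw [hstep]
    exact lintegral_indicator_mul_add_le hmle (measurable_iff_comap_le.1 (hrun.measurable_R t))
      (hrun.indep_R t) hLm hEm hYm hYint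

/-- The exponential of the (signed) error of the estimate after `n` choices of arm `a`, normalized
by the width of its confidence interval, on the event that `a` is chosen in round `t` for the
`(n + 1)`-st time. -/
def expError {K : ℕ} (p c σ r : ℝ) (n : ℕ) (act : ℕ → Fin K) (rew : ℕ → Fin K → ℝ)
    (a : Fin K) (t : ℕ) : ℝ≥0∞ :=
  if act t = a ∧ pulls act t a = n then
    ENNReal.ofReal (Real.exp (σ * ((estimate p c act rew t a - r) * ((n : ℝ) ^ (1 - 1 / p) / c))))
  else 0

lemma measurable_expError (hrun : IsRun P p c D μ R G A) (σ r : ℝ) (n : ℕ) (a : Fin K) (t : ℕ) :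
    Measurable fun ω => expError p c σ r n (fun s => A s ω) (fun s => R s ω) a t := by
  have hhist := history_le hrun.measurable_A hrun.measurable_R t
  refine Measurable.ite ?_ ?_ measurable_const
  · exact MeasurableSet.inter (hrun.measurable_A t (measurableSet_singleton a))
      (((measurable_history_pulls (R := R) le_rfl a).mono hhist le_rfl)
        (measurableSet_singleton n))
  · exact ((((((measurable_history_estimate p c t a).mono hhist le_rfl).sub_const r).mul_const
      _).const_mul σ).exp).ennreal_ofReal

/-- At most one round chooses `a` with count n. In that round the stopped exponent has exactly n
summands and total compensator nκ = b/c^p + σ r n^(1-1/p)/c, so it is the normalized error minus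
b/c^p, a constant free of n. -/
lemma sum_expError_le {act : ℕ → Fin K} {rew : ℕ → Fin K → ℝ} (hp1 : 1 < p) (hc : 0 < c)
    {b σ r κ : ℝ} {n : ℕ} (hn : 1 ≤ n) (a : Fin K)
    (hκ : κ = b / (c * (n : ℝ) ^ (1 / p)) ^ p + σ * r / (c * (n : ℝ) ^ (1 / p))) (T : ℕ) :
    ∑ t ∈ Finset.range T, expError p c σ r n act rew a t ≤
      ENNReal.ofReal (Real.exp (b / c ^ p)) *
        ENNReal.ofReal (Real.exp (stoppedExponent p c σ κ n act rew a T)) := by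
  have hp0 : 0 < p := by linarith
  have hn0 : (0 : ℝ) < n := by exact_mod_cast hn
  by_cases hex : ∃ t ∈ Finset.range T, act t = a ∧ pulls act t a = n
  · obtain ⟨t, htT, hact, hpull⟩ := hex
    have htT' := Finset.mem_range.1 htT
    rw [Finset.sum_eq_single_of_mem t htT]
    · rw [expError, if_pos ⟨hact, hpull⟩, ← ENNReal.ofReal_mul (Real.exp_pos _).le,
        ← Real.exp_add]
      refine ENNReal.ofReal_le_ofReal (Real.exp_le_exp.2 (le_of_eq ?_))
      have hset : ((Finset.range T).filter fun s => act s = a ∧ pulls act s a < n) =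
          (Finset.range t).filter fun s => act s = a := by
        ext s
        simp only [Finset.mem_filter, Finset.mem_range]
        constructor
        · rintro ⟨-, hs, hlt⟩
          refine ⟨?_, hs⟩
          by_contra! hle
          have := pulls_mono act a hle
          simp only at this
          omega
        · rintro ⟨hst, hs⟩
          exact ⟨hst.trans htT', hs, hpull ▸ pulls_lt_of_lt act hs hst⟩
      have hcard : ((Finset.range t).filter fun s => act s = a).card = n := hpull
      have hW : stoppedExponent p c σ κ n act rew a T =
          σ * (∑ s ∈ (Finset.range t).filter fun s => act s = a,
            influence p (rew s a / (c * (n : ℝ) ^ (1 / p)))) - n * κ := by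
        rw [stoppedExponent, ← Finset.sum_filter, hset, Finset.sum_sub_distrib, ← Finset.mul_sum,
          Finset.sum_const, hcard, nsmul_eq_mul]
        congr 2
        refine Finset.sum_congr rfl fun s hs => ?_
        rw [(Finset.mem_filter.1 hs).2]
      rw [hW, estimate, hpull, hκ]
      have h1 : ((c * (n : ℝ) ^ (1 / p)) ^ p) = c ^ p * n := by
        rw [Real.mul_rpow hc.le (by positivity), ← Real.rpow_mul hn0.le, one_div,
          inv_mul_cancel₀ hp0.ne', Real.rpow_one]
      have h2 : (n : ℝ) ^ (1 - 1 / p) = n / (n : ℝ) ^ (1 / p) := by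
        rw [Real.rpow_sub hn0, Real.rpow_one]
      rw [h1, h2]
      have h3 : 0 < (n : ℝ) ^ (1 / p) := by positivity
      have h4 : 0 < c ^ p := by positivity
      generalize (∑ s ∈ (Finset.range t).filter fun s => act s = a,
            influence p (rew s a / (c * (n : ℝ) ^ (1 / p)))) = S
      field_simp
      ring
    · intro s _ hne
      rw [expError, if_neg]
      rintro ⟨hs, hps⟩
      rcases lt_or_gt_of_ne hne with h | h
      · have := pulls_lt_of_lt act hs h
        omega
      · have := pulls_lt_of_lt act hact h
        omega
  · push Not at hex
    rw [Finset.sum_eq_zero]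
    · exact zero_le
    · intro t ht
      rw [expError, if_neg fun h => hex t ht h.1 h.2]

lemma sum_lintegral_expError_le [IsProbabilityMeasure P] [∀ a, IsProbabilityMeasure (D a)]
    (hrun : IsRun P p c D μ R G A) (hp1 : 1 < p) (hp2 : p ≤ 2)
    (hc : 0 < c) (hD : ∀ a, ∫⁻ x, ENNReal.ofReal (|x| ^ p) ∂(D a) ≤ νp)
    {σ : ℝ} (hσ : σ = 1 ∨ σ = -1) {n : ℕ} (hn : 1 ≤ n) (a : Fin K) (T : ℕ) :
    ∑ t ∈ Finset.range T,
      ∫⁻ ω, expError p c σ (meanReward D a) n (fun s => A s ω) (fun s => R s ω) a t ∂P ≤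
      ENNReal.ofReal (Real.exp (bConst p * νp / c ^ p)) := by
  rw [← lintegral_finsetSum _ fun t _ => measurable_expError hrun _ _ _ _ _]
  calc _ ≤ ∫⁻ ω, ENNReal.ofReal (Real.exp (bConst p * νp / c ^ p)) *
        ENNReal.ofReal (Real.exp (stoppedExponent p c σ _ n (fun s => A s ω)
          (fun s => R s ω) a T)) ∂P := lintegral_mono fun ω => sum_expError_le hp1 hc hn a rfl T
    _ ≤ ENNReal.ofReal (Real.exp (bConst p * νp / c ^ p)) * 1 := by
        rw [lintegral_const_mul' _ _ ENNReal.ofReal_ne_top]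
        gcongr
        exact lintegral_exp_stoppedExponent_le hrun hp1 hp2 hc hD hσ hn a rfl T
    _ = _ := mul_one _

end concentration

/-! ### Fresh perturbations -/

section perturbedChoice

variable {K : ℕ} {p c : ℝ} {μ : Measure ℝ} [IsProbabilityMeasure μ]

/-- The odds `F / (1 - F)`. -/
def odds (μ : Measure ℝ) (x : ℝ) : ℝ := pertCDF μ x / (1 - pertCDF μ x)

lemma measurable_odds : Measurable (odds μ) :=
  pertCDF_mono.measurable.div (measurable_const.sub pertCDF_mono.measurable)

/-- For independent coordinates with law `μ`: all of them lie below their thresholds with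
probability the odds times the probability that all but one do. -/
lemma pi_all_lt_eq (hF : ∀ x, pertCDF μ x < 1) (y : Fin K → ℝ) (b : Fin K) :
    Measure.pi (fun _ : Fin K => μ) {g | ∀ j, g j < y j} =
      ENNReal.ofReal (odds μ (y b)) *
        Measure.pi (fun _ : Fin K => μ) {g | y b ≤ g b ∧ ∀ j, j ≠ b → g j < y j} := by
  have h1 : {g : Fin K → ℝ | ∀ j, g j < y j} = Set.univ.pi fun j => Set.Iio (y j) := by
    ext g; simp
  have h2 : {g : Fin K → ℝ | y b ≤ g b ∧ ∀ j, j ≠ b → g j < y j} =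
      Set.univ.pi fun j => if j = b then Set.Ici (y j) else Set.Iio (y j) := by
    ext g
    simp only [Set.mem_ofPred_eq, Set.mem_pi, Set.mem_univ, true_imp_iff]
    constructor
    · rintro ⟨hb, hj⟩ j
      split_ifs with h
      · exact h ▸ hb
      · exact hj j h
    · intro h
      refine ⟨by simpa using h b, fun j hj => by simpa [hj] using h j⟩
  rw [h1, h2, Measure.pi_pi, Measure.pi_pi, ← Finset.mul_prod_erase _ _ (Finset.mem_univ b),
    ← Finset.mul_prod_erase _ _ (Finset.mem_univ b), ← mul_assoc]
  congr 1
  · have hpos : 0 < 1 - pertCDF μ (y b) := sub_pos.2 (hF _)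
    have h3 : μ (Set.Ici (y b)) = ENNReal.ofReal (1 - pertCDF μ (y b)) := by
      rw [one_sub_pertCDF, ofReal_measureReal]
    rw [if_pos rfl, h3, odds, ← ENNReal.ofReal_mul (div_nonneg (pertCDF_nonneg _ _) hpos.le),
      div_mul_cancel₀ _ hpos.ne', pertCDF, ofReal_measureReal]
  · refine Finset.prod_congr rfl fun j hj => ?_
    rw [if_neg (Finset.ne_of_mem_erase hj)]

/-- The rescaled distance of the estimate of arm `a` to the level `θ`. -/
def level {K : ℕ} (p c θ : ℝ) (act : ℕ → Fin K) (rew : ℕ → Fin K → ℝ) (t : ℕ) (a : Fin K) : ℝ :=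
  (θ - estimate p c act rew t a) / (c / (pulls act t a : ℝ) ^ (1 - 1 / p))

lemma measurable_history_level {Ω : Type*} {R : ℕ → Ω → Fin K → ℝ} {A : ℕ → Ω → Fin K} (θ : ℝ) (t : ℕ) (a : Fin K) :
    Measurable[history A R t] fun ω => level p c θ (fun s => A s ω) (fun s => R s ω) t a := by
  have hp : Measurable[history A R t] (fun ω => (pulls (fun s => A s ω) t a : ℝ)) :=
    measurable_from_nat.comp (measurable_history_pulls le_rfl a)
  exact (measurable_const.sub (measurable_history_estimate p c t a)).div
    (measurable_const.div (hp.pow_const _))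

lemma perturbedEstimate_lt_iff (hc : 0 < c) {act : ℕ → Fin K} {rew pert : ℕ → Fin K → ℝ} {t : ℕ}
    {a : Fin K} (h : 1 ≤ pulls act t a) (θ : ℝ) :
    perturbedEstimate p c act rew pert t a < θ ↔ pert t a < level p c θ act rew t a := by
  have h0 : (0 : ℝ) < pulls act t a := by exact_mod_cast h
  have hβ : 0 < c / (pulls act t a : ℝ) ^ (1 - 1 / p) := by positivity
  rw [level, lt_div_iff₀ hβ, perturbedEstimate]
  constructor <;> intro h <;> linarith

/-- In round `t`, the probability that no perturbed estimate reaches `θ` is bounded by the expected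
odds on the event that arm `b` is chosen. -/
lemma measure_all_lt_le {Ω : Type*} [mΩ : MeasurableSpace Ω] {P : Measure Ω}
    [IsProbabilityMeasure P] {D : Fin K → Measure ℝ} {R G : ℕ → Ω → Fin K → ℝ}
    {A : ℕ → Ω → Fin K} (hrun : IsRun P p c D μ R G A) (hc : 0 < c)
    (hF : ∀ x, pertCDF μ x < 1) {t : ℕ} (ht : K ≤ t) (θ : ℝ) (b : Fin K) :
    P {ω | ∀ j, perturbedEstimate p c (fun s => A s ω) (fun s => R s ω) (fun s => G s ω) t j < θ} ≤
      ∫⁻ ω, (if A t ω = b then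
        ENNReal.ofReal (odds μ (level p c θ (fun s => A s ω) (fun s => R s ω) t b)) else 0) ∂P := by
  set Y : Ω → Fin K → ℝ := fun ω j => level p c θ (fun s => A s ω) (fun s => R s ω) t j with hY
  have hhist := history_le hrun.measurable_A hrun.measurable_R t
  have hYh : Measurable[history A R t] Y :=
    @measurable_pi_lambda _ _ _ (history A R t) _ _ fun j => measurable_history_level θ t j
  have hYm : Measurable Y := hYh.mono hhist le_rfl
  have hlt : ∀ ω j, perturbedEstimate p c (fun s => A s ω) (fun s => R s ω) (fun s => G s ω) t j < θ
      ↔ G t ω j < Y ω j := fun ω j =>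
    perturbedEstimate_lt_iff hc (one_le_pulls _ ht (fun s hs => hrun.init s hs ω) j) θ
  -- The levels depend on the history alone, so the joint law with the fresh perturbations is a
  -- product and `pi_all_lt_eq` applies for each fixed value of the levels.
  have hind : IndepFun Y (G t) P := by
    rw [IndepFun_iff_Indep]
    exact indep_of_indep_of_le_left (hrun.indep_G t) (measurable_iff_comap_le.1 hYh)
  have hmap := (indepFun_iff_map_prod_eq_prod_map_map hYm.aemeasurable
    (hrun.measurable_G t).aemeasurable).1 hind
  rw [hrun.law_G t] at hmap
  have : IsProbabilityMeasure (P.map Y) := Measure.isProbabilityMeasure_map hYm.aemeasurable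
  have hYG : Measurable fun ω => (Y ω, G t ω) := hYm.prodMk (hrun.measurable_G t)
  set S₁ : Set ((Fin K → ℝ) × (Fin K → ℝ)) := {q | ∀ j, q.2 j < q.1 j} with hS₁
  set S₂ : Set ((Fin K → ℝ) × (Fin K → ℝ)) := {q | q.1 b ≤ q.2 b ∧ ∀ j, j ≠ b → q.2 j < q.1 j}
    with hS₂
  have hmeas_lt : ∀ j, MeasurableSet {q : (Fin K → ℝ) × (Fin K → ℝ) | q.2 j < q.1 j} := fun j =>
    measurableSet_lt ((measurable_pi_apply j).comp measurable_snd)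
      ((measurable_pi_apply j).comp measurable_fst)
  have hS₁m : MeasurableSet S₁ := by
    rw [hS₁, Set.ofPred_forall]
    exact MeasurableSet.iInter hmeas_lt
  have hS₂m : MeasurableSet S₂ := by
    refine MeasurableSet.inter (measurableSet_le ((measurable_pi_apply b).comp measurable_fst)
      ((measurable_pi_apply b).comp measurable_snd)) ?_
    have : {q : (Fin K → ℝ) × (Fin K → ℝ) | ∀ j, j ≠ b → q.2 j < q.1 j} =
        ⋂ j, ⋂ (_ : j ≠ b), {q | q.2 j < q.1 j} := by ext; simp
    change MeasurableSet {q : (Fin K → ℝ) × (Fin K → ℝ) | ∀ j, j ≠ b → q.2 j < q.1 j}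
    rw [this]
    exact MeasurableSet.iInter fun j => MeasurableSet.iInter fun _ => hmeas_lt j
  have hφ : Measurable fun q : (Fin K → ℝ) × (Fin K → ℝ) => ENNReal.ofReal (odds μ (q.1 b)) :=
    (measurable_odds.comp ((measurable_pi_apply b).comp measurable_fst)).ennreal_ofReal
  calc P {ω | ∀ j, perturbedEstimate p c (fun s => A s ω) (fun s => R s ω)
          (fun s => G s ω) t j < θ}
      = P ((fun ω => (Y ω, G t ω)) ⁻¹' S₁) := by
        congr 1
        ext ω
        simp only [Set.mem_ofPred_eq, Set.mem_preimage, hS₁]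
        exact forall_congr' (hlt ω)
    _ = ((P.map Y).prod (Measure.pi fun _ => μ)) S₁ := by
        rw [← hmap, Measure.map_apply hYG hS₁m]
    _ = ∫⁻ y, Measure.pi (fun _ => μ) (Prod.mk y ⁻¹' S₁) ∂(P.map Y) :=
        Measure.prod_apply hS₁m
    _ = ∫⁻ y, ∫⁻ g, S₂.indicator (fun q => ENNReal.ofReal (odds μ (q.1 b))) (y, g)
          ∂(Measure.pi fun _ => μ) ∂(P.map Y) := by
        refine lintegral_congr fun y => ?_
        have h := pi_all_lt_eq hF y b
        have hS : (Prod.mk y ⁻¹' S₂) = {g | y b ≤ g b ∧ ∀ j, j ≠ b → g j < y j} := rfl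
        have h2 : ∀ g, S₂.indicator (fun q => ENNReal.ofReal (odds μ (q.1 b))) (y, g) =
            (Prod.mk y ⁻¹' S₂).indicator (fun _ => ENNReal.ofReal (odds μ (y b))) g :=
          fun g => rfl
        simp_rw [h2]
        rw [lintegral_indicator_const (measurable_prodMk_left hS₂m)]
        exact h
    _ = ∫⁻ q, S₂.indicator (fun q => ENNReal.ofReal (odds μ (q.1 b))) q
          ∂((P.map Y).prod (Measure.pi fun _ => μ)) :=
        (lintegral_prod _ (hφ.indicator hS₂m).aemeasurable).symm
    _ = ∫⁻ ω, S₂.indicator (fun q => ENNReal.ofReal (odds μ (q.1 b))) (Y ω, G t ω) ∂P := by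
        rw [← hmap, lintegral_map (hφ.indicator hS₂m) hYG]
    _ ≤ _ := by
        refine lintegral_mono fun ω => ?_
        by_cases hω : (Y ω, G t ω) ∈ S₂
        -- Only `b` reaches θ, so the decision rule forces its choice.
        · have hA : A t ω = b := by
            by_contra hne
            have h1 := hrun.argmax t ht ω b
            have h2 := (hlt ω (A t ω)).2 (hω.2 _ hne)
            exact absurd ((hlt ω b).1 (h1.trans_lt h2)) (not_lt.2 hω.1)
          rw [Set.indicator_of_mem hω, if_pos hA]
        · rw [Set.indicator_of_notMem hω]
          exact zero_le

end perturbedChoice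

/-! ### Sums of counts -/

section counts

/-- Without n = 0 there is no extra 1, unlike in `sum_indicator_le`. -/
lemma sum_indicator_Icc_le {x : ℝ} (hx : 0 ≤ x) (N : ℕ) :
    ∑ n ∈ Finset.range N, (if 1 ≤ n ∧ (n : ℝ) ≤ x then (1 : ℝ) else 0) ≤ x := by
  rw [← Finset.sum_filter, Finset.sum_const, nsmul_eq_mul, mul_one]
  refine le_trans ?_ (Nat.floor_le hx)
  have : (Finset.range N).filter (fun n : ℕ => 1 ≤ n ∧ (n : ℝ) ≤ x) ⊆ Finset.Icc 1 ⌊x⌋₊ := by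
    intro n hn
    obtain ⟨-, h1, h2⟩ := Finset.mem_filter.1 hn
    exact Finset.mem_Icc.2 ⟨h1, Nat.le_floor h2⟩
  have := Finset.card_le_card this
  simp only [Nat.card_Icc, Nat.add_sub_cancel] at this
  exact_mod_cast this

lemma sum_indicator_le {x : ℝ} (hx : 0 ≤ x) (N : ℕ) :
    ∑ n ∈ Finset.range N, (if (n : ℝ) ≤ x then (1 : ℝ) else 0) ≤ x + 1 := by
  rw [← Finset.sum_filter, Finset.sum_const, nsmul_eq_mul, mul_one]
  have : (Finset.range N).filter (fun n : ℕ => (n : ℝ) ≤ x) ⊆ Finset.range (⌊x⌋₊ + 1) := by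
    intro n hn
    exact Finset.mem_range.2 (Nat.lt_succ_of_le (Nat.le_floor (Finset.mem_filter.1 hn).2))
  have := Finset.card_le_card this
  rw [Finset.card_range] at this
  have h2 : (((Finset.range N).filter fun n : ℕ => (n : ℝ) ≤ x).card : ℝ) ≤ ⌊x⌋₊ + 1 := by
    exact_mod_cast this
  linarith [Nat.floor_le hx]

/-- Turns a quantile z into the count beyond which the margin α n^e exceeds it. -/
lemma lt_mul_rpow_of_lt {α e z x : ℝ} (hα : 0 < α) (he : 0 < e)
    (h : (max z 0 / α) ^ (1 / e) < x) : z < α * x ^ e := by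
  have h0 : 0 ≤ max z 0 / α := div_nonneg (le_max_right _ _) hα.le
  have h1 : max z 0 / α < x ^ e := by
    have := Real.rpow_lt_rpow (by positivity) h he
    rwa [← Real.rpow_mul h0, one_div, inv_mul_cancel₀ he.ne', Real.rpow_one] at this
  rw [div_lt_iff₀ hα] at h1
  linarith [le_max_left z 0]

lemma pulls_eq_zero_of_lt {K : ℕ} {act : ℕ → Fin K}
    (hinit : ∀ (s : ℕ) (hs : s < K), act s = ⟨s, hs⟩) {t : ℕ} (ht : t < K) :
    pulls act t (act t) = 0 := by
  rw [pulls, Finset.card_eq_zero, Finset.filter_eq_empty_iff]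
  intro s hs h
  have hst := Finset.mem_range.1 hs
  rw [hinit t ht, hinit s (hst.trans ht), Fin.mk.injEq] at h
  omega

end counts

/-! ### The number of choices of a suboptimal arm -/

section choices

variable {Ω : Type*} [mΩ : MeasurableSpace Ω] {P : Measure Ω} {K : ℕ}
  {p c : ℝ} {D : Fin K → Measure ℝ} {μ : Measure ℝ}
  {R G : ℕ → Ω → Fin K → ℝ} {A : ℕ → Ω → Fin K} {νp : ℝ≥0}

lemma measurable_choice_weight (hrun : IsRun P p c D μ R G A) (f : ℕ → ℝ≥0∞) (a : Fin K) (t : ℕ) :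
    Measurable fun ω => if A t ω = a then f (pulls (fun s => A s ω) t a) else 0 := by
  have hhist := history_le hrun.measurable_A hrun.measurable_R t
  exact Measurable.ite (hrun.measurable_A t (measurableSet_singleton a))
    (measurable_from_nat.comp ((measurable_history_pulls (R := R) le_rfl a).mono hhist le_rfl))
    measurable_const

/-- Successive choices of an arm run through the counts 0, 1, 2, …, so each weight is spent at most
once. -/
lemma sum_lintegral_choice_weight_le [IsProbabilityMeasure P] (hrun : IsRun P p c D μ R G A) {f : ℕ → ℝ≥0∞} {B : ℝ≥0∞}
    {T : ℕ} (hf : ∀ N ≤ T, ∑ n ∈ Finset.range N, f n ≤ B) (a : Fin K) :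
    ∑ t ∈ Finset.range T,
      ∫⁻ ω, (if A t ω = a then f (pulls (fun s => A s ω) t a) else 0) ∂P ≤ B := by
  rw [← lintegral_finsetSum _ fun t _ => measurable_choice_weight hrun f a t]
  calc _ ≤ ∫⁻ _, B ∂P := lintegral_mono fun ω =>
        (sum_pulls (fun s => A s ω) f T a).trans_le (hf _ (pulls_le _ _ _))
    _ = B := by simp

/-- Exchanging the sums leaves a uniform constant for each count, so only the weights are summed.
The shift to n + 1 excludes count 0, where the concentration bound is unavailable. -/
lemma sum_weighted_expError_le [IsProbabilityMeasure P] [∀ a, IsProbabilityMeasure (D a)]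
    (hrun : IsRun P p c D μ R G A)
    (hp1 : 1 < p) (hp2 : p ≤ 2) (hc : 0 < c)
    (hD : ∀ a, ∫⁻ x, ENNReal.ofReal (|x| ^ p) ∂(D a) ≤ νp) {σ : ℝ} (hσ : σ = 1 ∨ σ = -1)
    (a : Fin K) {α e : ℝ} (hα : 0 < α) (he : 0 < e) (T : ℕ) :
    ∑ t ∈ Finset.range T, ∑ n ∈ Finset.range T,
      ENNReal.ofReal (Real.exp (-α * ((n + 1 : ℕ) : ℝ) ^ e)) *
        ∫⁻ ω, expError p c σ (meanReward D a) (n + 1) (fun s => A s ω) (fun s => R s ω) a t ∂P ≤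
      ENNReal.ofReal (Real.exp (bConst p * νp / c ^ p) *
        (Real.Gamma (1 / e + 1) * α ^ (-1 / e))) := by
  rw [Finset.sum_comm]
  calc _ ≤ ∑ n ∈ Finset.range T, ENNReal.ofReal (Real.exp (-α * ((n + 1 : ℕ) : ℝ) ^ e)) *
        ENNReal.ofReal (Real.exp (bConst p * νp / c ^ p)) := by
        refine Finset.sum_le_sum fun n _ => ?_
        rw [← Finset.mul_sum]
        gcongr
        exact sum_lintegral_expError_le hrun hp1 hp2 hc hD hσ (by omega) a T
    _ = ENNReal.ofReal (Real.exp (bConst p * νp / c ^ p) *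
          ∑ n ∈ Finset.range T, Real.exp (-α * ((n + 1 : ℕ) : ℝ) ^ e)) := by
        rw [← Finset.sum_mul, ← ENNReal.ofReal_sum_of_nonneg fun n _ => (Real.exp_pos _).le,
          mul_comm, ENNReal.ofReal_mul (Real.exp_pos _).le]
    _ ≤ _ := by
        apply ENNReal.ofReal_le_ofReal
        gcongr
        exact sum_exp_neg_mul_rpow_le he hα T

/-- Replaces the random count by a sum over all counts, of which only the actual one contributes;
the deterministic weights can then leave the expectation. -/
lemma one_le_ofReal_exp_mul_expError {act : ℕ → Fin K} {rew : ℕ → Fin K → ℝ} {a : Fin K} {t T : ℕ}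
    {σ r : ℝ} {w x : ℝ} (hact : act t = a) (hn : 1 ≤ pulls act t a) (htT : t < T) {g : ℕ → ℝ≥0∞}
    (hg : g (pulls act t a - 1) = ENNReal.ofReal w) (hw : 0 ≤ w)
    (hx : x ≤ w * Real.exp (σ * ((estimate p c act rew t a - r) *
      ((pulls act t a : ℝ) ^ (1 - 1 / p) / c)))) :
    ENNReal.ofReal x ≤ ∑ n ∈ Finset.range T, g n * expError p c σ r (n + 1) act rew a t := by
  have hmem : pulls act t a - 1 ∈ Finset.range T := by
    have := pulls_le act t a
    rw [Finset.mem_range]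
    omega
  refine le_trans ?_ (Finset.single_le_sum
    (f := fun n => g n * expError p c σ r (n + 1) act rew a t) (fun _ _ => zero_le) hmem)
  have h1 : pulls act t a - 1 + 1 = pulls act t a := by omega
  simp only [h1, hg]
  rw [expError, if_pos ⟨hact, rfl⟩, ← ENNReal.ofReal_mul hw]
  exact ENNReal.ofReal_le_ofReal hx

/-- A choice of a suboptimal arm `a` is early, or the arm is overestimated, or its perturbation is
large, or no perturbed estimate reaches the level of the optimal arm. -/
lemma choice_indicator_le (hrun : IsRun P p c D μ R G A) (hp1 : 1 < p) (hc : 0 < c)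
    {a : Fin K} (ha : 0 < gap D a) {x : ℝ} (hx : 0 ≤ x) {t T : ℕ} (htT : t < T) (ω : Ω) :
    (if A t ω = a then 1 else 0 : ℝ≥0∞) ≤
      (if A t ω = a then
        (fun n : ℕ => ENNReal.ofReal (if (n : ℝ) ≤ x then 1 else 0)) (pulls (fun s => A s ω) t a)
        else 0) +
      (∑ n ∈ Finset.range T,
        ENNReal.ofReal (Real.exp (-(gap D a / (3 * c)) * ((n + 1 : ℕ) : ℝ) ^ (1 - 1 / p))) *
          expError p c 1 (meanReward D a) (n + 1) (fun s => A s ω) (fun s => R s ω) a t) +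
      {ω | gap D a / (3 * c) * ((⌊x⌋₊ + 1 : ℕ) : ℝ) ^ (1 - 1 / p) ≤ G t ω a}.indicator 1 ω +
      {ω | K ≤ t ∧ ∀ j, perturbedEstimate p c (fun s => A s ω) (fun s => R s ω)
        (fun s => G s ω) t j < bestMean D - gap D a / 3}.indicator 1 ω := by
  by_cases hA : A t ω = a
  swap
  · simp [hA]
  simp only [hA, if_true]
  set Δ := gap D a with hΔ
  set act : ℕ → Fin K := fun s => A s ω with hact
  set rew : ℕ → Fin K → ℝ := fun s => R s ω with hrew
  set n := pulls act t a with hn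
  have he : 0 < 1 - 1 / p := by
    rw [sub_pos, div_lt_one (by linarith)]
    exact hp1
  by_cases hnx : (n : ℝ) ≤ x
  · rw [if_pos hnx, ENNReal.ofReal_one]
    exact le_add_right (le_add_right (le_add_right le_rfl))
  push Not at hnx
  have hn1 : 1 ≤ n := by
    have : (0 : ℝ) < n := hx.trans_lt hnx
    exact_mod_cast this
  have hn0 : (0 : ℝ) < n := by exact_mod_cast hn1
  have hKt : K ≤ t := by
    by_contra! hlt
    have h0 := pulls_eq_zero_of_lt (act := act) (fun s hs => hrun.init s hs ω) hlt
    rw [show act t = a from hA] at h0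
    omega
  -- The level θ lies 2Δ/3 above r_a: one third of the gap is allowed to the estimation error of
  -- `a`, one to its perturbation. In the first case the indicator is bounded by an exponential, as
  -- in Chernoff's method.
  rcases lt_or_ge (meanReward D a + Δ / 3) (estimate p c act rew t a) with hest | hest
  · refine le_add_right (le_add_right (le_add_left ?_))
    have h := one_le_ofReal_exp_mul_expError (p := p) (c := c) (rew := rew) (σ := 1)
      (r := meanReward D a) (x := 1)
      (w := Real.exp (-(Δ / (3 * c)) * (n : ℝ) ^ (1 - 1 / p)))
      (g := fun n => ENNReal.ofReal (Real.exp (-(Δ / (3 * c)) * ((n + 1 : ℕ) : ℝ) ^ (1 - 1 / p))))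
      hA hn1 htT (by simp only [← hn, Nat.sub_add_cancel hn1]) (Real.exp_pos _).le ?_
    · simpa using h
    · rw [← hn, ← Real.exp_add, one_mul]
      apply Real.one_le_exp
      have h1 : 0 < (n : ℝ) ^ (1 - 1 / p) / c := by positivity
      have h2 : Δ / (3 * c) * (n : ℝ) ^ (1 - 1 / p) = Δ / 3 * ((n : ℝ) ^ (1 - 1 / p) / c) := by
        field_simp
      have h3 : Δ / 3 * ((n : ℝ) ^ (1 - 1 / p) / c) ≤
          (estimate p c act rew t a - meanReward D a) * ((n : ℝ) ^ (1 - 1 / p) / c) := by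
        gcongr
        linarith
      linarith
  · by_cases hθ : perturbedEstimate p c act rew (fun s => G s ω) t a < bestMean D - Δ / 3
    · refine le_add_left ?_
      rw [Set.indicator_of_mem]
      · rfl
      · refine ⟨hKt, fun j => lt_of_le_of_lt ?_ hθ⟩
        have := hrun.argmax t hKt ω j
        rwa [hA] at this
    · refine le_add_right (le_add_left ?_)
      rw [Set.indicator_of_mem]
      · rfl
      · push Not at hθ
        rw [perturbedEstimate, ← hn] at hθ
        -- The random count is replaced by the fixed smallest one above x, so that the event
        -- concerns `G t ω a` alone.
        have hfl : ((⌊x⌋₊ + 1 : ℕ) : ℝ) ≤ n := by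
          have : ⌊x⌋₊ < n := (Nat.floor_lt hx).2 hnx
          exact_mod_cast this
        have h1 : ((⌊x⌋₊ + 1 : ℕ) : ℝ) ^ (1 - 1 / p) ≤ (n : ℝ) ^ (1 - 1 / p) :=
          Real.rpow_le_rpow (by positivity) hfl he.le
        have h2 : 0 < (n : ℝ) ^ (1 - 1 / p) := by positivity
        have h3 : Δ / 3 ≤ c / (n : ℝ) ^ (1 - 1 / p) * G t ω a := by
          have : bestMean D = Δ + meanReward D a := by rw [hΔ, gap]; ring
          linarith
        have h4 : Δ / (3 * c) * (n : ℝ) ^ (1 - 1 / p) ≤ G t ω a := by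
          have h5 : Δ / (3 * c) * (n : ℝ) ^ (1 - 1 / p) =
              Δ / 3 * ((n : ℝ) ^ (1 - 1 / p) / c) := by field_simp
          have h6 : G t ω a = c / (n : ℝ) ^ (1 - 1 / p) * G t ω a *
              ((n : ℝ) ^ (1 - 1 / p) / c) := by field_simp
          rw [h5, h6]
          gcongr
        refine le_trans ?_ h4
        gcongr

/-- The odds for an optimal arm `b`, in terms of its underestimation. -/
lemma odds_indicator_le [IsProbabilityMeasure μ] (hc : 0 < c)
    {b : Fin K} (hb : meanReward D b = bestMean D) {Δ : ℝ} (hΔ : 0 < Δ) {C : ℝ} (hC : 0 < C)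
    (hodds : ∀ x m, 0 ≤ m → odds μ (x - m) ≤ 2 * pertCDF μ (-m / 2) + C * Real.exp (x - m / 2))
    {act : ℕ → Fin K} {rew : ℕ → Fin K → ℝ} {t T : ℕ} (htT : t < T)
    (hn1 : 1 ≤ pulls act t b) :
    (if act t = b then ENNReal.ofReal (odds μ (level p c (bestMean D - Δ / 3) act rew t b)) else 0) ≤
      (if act t = b then (fun n : ℕ => ENNReal.ofReal (if 1 ≤ n then
        2 * pertCDF μ (-(Δ / (3 * c) * (n : ℝ) ^ (1 - 1 / p)) / 2) else 0)) (pulls act t b) else 0) +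
      ENNReal.ofReal C * ∑ n ∈ Finset.range T,
        ENNReal.ofReal (Real.exp (-(Δ / (6 * c)) * ((n + 1 : ℕ) : ℝ) ^ (1 - 1 / p))) *
          expError p c (-1) (meanReward D b) (n + 1) act rew b t := by
  by_cases hA : act t = b
  swap
  · simp [hA]
  simp only [hA, if_true, hn1]
  set n := pulls act t b with hn
  have hn0 : (0 : ℝ) < n := by exact_mod_cast hn1
  have h2 : 0 < (n : ℝ) ^ (1 - 1 / p) := by positivity
  set X := -1 * ((estimate p c act rew t b - meanReward D b) * ((n : ℝ) ^ (1 - 1 / p) / c)) with hX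
  set m := Δ / (3 * c) * (n : ℝ) ^ (1 - 1 / p) with hm
  -- X is the normalized underestimation of `b`, m its normalized margin Δ/3. In exp(X - m/2) the
  -- first part is an `expError` with σ = -1, the second the summable weight.
  have hlev : level p c (bestMean D - Δ / 3) act rew t b = X - m := by
    rw [level, ← hn, hX, hm, hb]
    field_simp
    ring
  have h := hodds X m (by positivity)
  rw [hlev]
  refine (ENNReal.ofReal_le_ofReal h).trans ?_
  rw [ENNReal.ofReal_add (mul_nonneg zero_le_two (pertCDF_nonneg _ _)) (by positivity),
    ENNReal.ofReal_mul hC.le]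
  gcongr
  refine one_le_ofReal_exp_mul_expError (p := p) (c := c) (rew := rew) (σ := -1)
      (r := meanReward D b)
      (w := Real.exp (-(Δ / (6 * c)) * (n : ℝ) ^ (1 - 1 / p)))
      (g := fun n => ENNReal.ofReal (Real.exp (-(Δ / (6 * c)) * ((n + 1 : ℕ) : ℝ) ^ (1 - 1 / p))))
      hA hn1 htT (by simp only [← hn, Nat.sub_add_cancel hn1]) (Real.exp_pos _).le ?_
  rw [← hn, ← hX, ← Real.exp_add]
  apply Real.exp_le_exp.2
  rw [hm]
  apply le_of_eq
  field_simp
  ring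

lemma measurable_perturbedEstimate (hrun : IsRun P p c D μ R G A) (t : ℕ) (j : Fin K) :
    Measurable fun ω => perturbedEstimate p c (fun s => A s ω) (fun s => R s ω)
      (fun s => G s ω) t j := by
  have hhist := history_le hrun.measurable_A hrun.measurable_R t
  have hp : Measurable (fun ω => (pulls (fun s => A s ω) t j : ℝ)) :=
    measurable_from_nat.comp ((measurable_history_pulls (R := R) le_rfl j).mono hhist le_rfl)
  exact ((measurable_history_estimate p c t j).mono hhist le_rfl).add
    ((measurable_const.div (hp.pow_const _)).mul
      ((measurable_pi_apply j).comp (hrun.measurable_G t)))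

lemma measure_le_pert_eq [IsProbabilityMeasure μ] (hrun : IsRun P p c D μ R G A) (t : ℕ)
    (a : Fin K) (x : ℝ) : P {ω | x ≤ G t ω a} = ENNReal.ofReal (1 - pertCDF μ x) := by
  have h1 : P {ω | x ≤ G t ω a} = (P.map (G t)) ((fun g => g a) ⁻¹' Set.Ici x) := by
    rw [Measure.map_apply (hrun.measurable_G t)
      (measurable_pi_apply a measurableSet_Ici)]
    rfl
  rw [h1, hrun.law_G t,
    (measurePreserving_eval (fun _ : Fin K => μ) a).measure_preimage
      measurableSet_Ici.nullMeasurableSet, one_sub_pertCDF, ofReal_measureReal]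

/-- The odds bound turns the rounds into choices of the optimal arm `b`. Up to x counts cost at most
1 each in the left-tail part, and at most T others cost 2y each; the exponential part is handled by
`sum_weighted_expError_le`. -/
lemma sum_measure_all_lt_le [IsProbabilityMeasure P] [IsProbabilityMeasure μ]
    [∀ a, IsProbabilityMeasure (D a)]
    (hrun : IsRun P p c D μ R G A) (hp1 : 1 < p) (hp2 : p ≤ 2) (hc : 0 < c)
    (hD : ∀ a, ∫⁻ x, ENNReal.ofReal (|x| ^ p) ∂(D a) ≤ νp) (hF : ∀ x, pertCDF μ x < 1)
    (hhalf : pertCDF μ 0 ≤ 1 / 2)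
    {b : Fin K} (hb : meanReward D b = bestMean D) {Δ : ℝ} (hΔ : 0 < Δ) {C : ℝ} (hC : 0 < C)
    (hodds : ∀ x m, 0 ≤ m → odds μ (x - m) ≤ 2 * pertCDF μ (-m / 2) + C * Real.exp (x - m / 2))
    (T : ℕ) {x y : ℝ} (hx : 0 ≤ x) (hy : 0 ≤ y)
    (hxy : ∀ n : ℕ, x < n → pertCDF μ (-(Δ / (3 * c) * (n : ℝ) ^ (1 - 1 / p)) / 2) ≤ y) :
    ∑ t ∈ Finset.range T, P {ω | K ≤ t ∧ ∀ j, perturbedEstimate p c (fun s => A s ω)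
        (fun s => R s ω) (fun s => G s ω) t j < bestMean D - Δ / 3} ≤
      ENNReal.ofReal (x + T * (2 * y)) + ENNReal.ofReal C *
        ENNReal.ofReal (Real.exp (bConst p * νp / c ^ p) *
          (Real.Gamma (1 / (1 - 1 / p) + 1) * (Δ / (6 * c)) ^ (-1 / (1 - 1 / p)))) := by
  have he : 0 < 1 - 1 / p := by
    rw [sub_pos, div_lt_one (by linarith)]
    exact hp1
  set f : ℕ → ℝ := fun n => if 1 ≤ n then
    2 * pertCDF μ (-(Δ / (3 * c) * (n : ℝ) ^ (1 - 1 / p)) / 2) else 0 with hf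
  have hf0 : ∀ n, 0 ≤ f n := fun n => by
    simp only [hf]
    split_ifs
    · exact mul_nonneg zero_le_two (pertCDF_nonneg _ _)
    · exact le_rfl
  have hfle : ∀ n, f n ≤ (if 1 ≤ n ∧ (n : ℝ) ≤ x then 1 else 0) + 2 * y := by
    intro n
    simp only [hf]
    by_cases h1 : 1 ≤ n
    · by_cases h2 : (n : ℝ) ≤ x
      · rw [if_pos h1, if_pos ⟨h1, h2⟩]
        -- Here F(0) ≤ 1/2 bounds the weight 2F by 1.
        have h3 : -(Δ / (3 * c) * (n : ℝ) ^ (1 - 1 / p)) / 2 ≤ 0 := by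
          have : 0 ≤ Δ / (3 * c) * (n : ℝ) ^ (1 - 1 / p) := by positivity
          linarith
        have := pertCDF_mono (μ := μ) h3
        linarith
      · rw [if_pos h1, if_neg (fun h => h2 h.2)]
        have := hxy n (not_le.1 h2)
        linarith
    · rw [if_neg h1]
      split_ifs <;> linarith
  have hfsum : ∀ N ≤ T, ∑ n ∈ Finset.range N, ENNReal.ofReal (f n) ≤
      ENNReal.ofReal (x + T * (2 * y)) := by
    intro N hN
    rw [← ENNReal.ofReal_sum_of_nonneg fun n _ => hf0 n]
    apply ENNReal.ofReal_le_ofReal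
    calc ∑ n ∈ Finset.range N, f n
        ≤ ∑ n ∈ Finset.range N, ((if 1 ≤ n ∧ (n : ℝ) ≤ x then 1 else 0) + 2 * y) :=
          Finset.sum_le_sum fun n _ => hfle n
      _ ≤ x + T * (2 * y) := by
          rw [Finset.sum_add_distrib, Finset.sum_const, Finset.card_range, nsmul_eq_mul]
          have := sum_indicator_Icc_le hx N
          have h3 : (N : ℝ) ≤ T := by exact_mod_cast hN
          gcongr
  have hterm : ∀ t ∈ Finset.range T, P {ω | K ≤ t ∧ ∀ j, perturbedEstimate p c (fun s => A s ω)
        (fun s => R s ω) (fun s => G s ω) t j < bestMean D - Δ / 3} ≤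
      (∫⁻ ω, (if A t ω = b then (fun n => ENNReal.ofReal (f n)) (pulls (fun s => A s ω) t b)
        else 0) ∂P) +
      ENNReal.ofReal C * ∑ n ∈ Finset.range T,
        ENNReal.ofReal (Real.exp (-(Δ / (6 * c)) * ((n + 1 : ℕ) : ℝ) ^ (1 - 1 / p))) *
          ∫⁻ ω, expError p c (-1) (meanReward D b) (n + 1) (fun s => A s ω) (fun s => R s ω) b t
            ∂P := by
    intro t ht
    rcases lt_or_ge t K with hlt | hKt
    · have : ¬ K ≤ t := by omega
      simp [this]
    · have h1 := measure_all_lt_le hrun hc hF hKt (bestMean D - Δ / 3) b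
      simp only [hKt, true_and]
      refine h1.trans ?_
      refine (lintegral_mono fun ω => odds_indicator_le hc hb hΔ hC hodds
        (Finset.mem_range.1 ht)
        (one_le_pulls _ hKt (fun s hs => hrun.init s hs ω) b)).trans (le_of_eq ?_)
      rw [lintegral_add_left (measurable_choice_weight hrun (fun n => ENNReal.ofReal (f n)) b t),
        lintegral_const_mul' _ _ ENNReal.ofReal_ne_top, lintegral_finsetSum]
      · congr 2
        exact Finset.sum_congr rfl fun n _ => lintegral_const_mul' _ _ ENNReal.ofReal_ne_top
      · exact fun n _ => (measurable_expError hrun _ _ _ _ _).const_mul _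
  refine (Finset.sum_le_sum hterm).trans ?_
  rw [Finset.sum_add_distrib, ← Finset.mul_sum]
  gcongr
  · exact sum_lintegral_choice_weight_le hrun hfsum b
  · exact sum_weighted_expError_le hrun hp1 hp2 hc hD (Or.inr rfl) b (by positivity) he T

/-- The expected number of choices of a suboptimal arm. -/
lemma sum_measure_choice_le [IsProbabilityMeasure P] [IsProbabilityMeasure μ]
    [∀ a, IsProbabilityMeasure (D a)]
    (hrun : IsRun P p c D μ R G A) (hp1 : 1 < p) (hp2 : p ≤ 2) (hc : 0 < c)
    (hD : ∀ a, ∫⁻ x, ENNReal.ofReal (|x| ^ p) ∂(D a) ≤ νp) (hF : ∀ x, pertCDF μ x < 1)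
    (hhalf : pertCDF μ 0 ≤ 1 / 2)
    {a b : Fin K} (hb : meanReward D b = bestMean D) (ha : 0 < gap D a) {C : ℝ} (hC : 0 < C)
    (hodds : ∀ x m, 0 ≤ m → odds μ (x - m) ≤ 2 * pertCDF μ (-m / 2) + C * Real.exp (x - m / 2))
    (T : ℕ) {x x' y : ℝ} (hx : 0 ≤ x) (hx' : 0 ≤ x') (hy : 0 ≤ y)
    (hxy : ∀ n : ℕ, x < n → pertCDF μ (-(gap D a / (3 * c) * (n : ℝ) ^ (1 - 1 / p)) / 2) ≤ y)
    (hxy' : ∀ n : ℕ, x' < n → 1 - pertCDF μ (gap D a / (3 * c) * (n : ℝ) ^ (1 - 1 / p)) ≤ y) :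
    ∑ t ∈ Finset.range T, P.real {ω | A t ω = a} ≤
      x' + 1 + Real.exp (bConst p * νp / c ^ p) * (Real.Gamma (1 / (1 - 1 / p) + 1) *
        (gap D a / (3 * c)) ^ (-1 / (1 - 1 / p))) + T * y +
      (x + T * (2 * y) + C * (Real.exp (bConst p * νp / c ^ p) *
        (Real.Gamma (1 / (1 - 1 / p) + 1) * (gap D a / (6 * c)) ^ (-1 / (1 - 1 / p))))) := by
  have he : 0 < 1 - 1 / p := by
    rw [sub_pos, div_lt_one (by linarith)]
    exact hp1
  have hΓ : 0 < Real.Gamma (1 / (1 - 1 / p) + 1) := Real.Gamma_pos_of_pos (by positivity)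
  have hmeasA : ∀ t, MeasurableSet {ω | A t ω = a} := fun t =>
    hrun.measurable_A t (measurableSet_singleton a)
  have hmeasG : ∀ t z, MeasurableSet {ω | z ≤ G t ω a} := fun t z =>
    measurableSet_le measurable_const ((measurable_pi_apply a).comp (hrun.measurable_G t))
  have hmeasB : ∀ t, MeasurableSet {ω | K ≤ t ∧ ∀ j, perturbedEstimate p c (fun s => A s ω)
      (fun s => R s ω) (fun s => G s ω) t j < bestMean D - gap D a / 3} := by
    intro t
    have h := fun j => measurableSet_lt (measurable_perturbedEstimate hrun t j)
      (measurable_const (a := bestMean D - gap D a / 3))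
    refine MeasurableSet.inter (MeasurableSet.const _) ?_
    have : {ω | ∀ j, perturbedEstimate p c (fun s => A s ω) (fun s => R s ω) (fun s => G s ω) t j <
        bestMean D - gap D a / 3} = ⋂ j, {ω | perturbedEstimate p c (fun s => A s ω)
        (fun s => R s ω) (fun s => G s ω) t j < bestMean D - gap D a / 3} := by ext; simp
    change MeasurableSet {ω | ∀ j, perturbedEstimate p c (fun s => A s ω) (fun s => R s ω)
      (fun s => G s ω) t j < bestMean D - gap D a / 3}
    rw [this]
    exact MeasurableSet.iInter h
  have hterm : ∀ t ∈ Finset.range T, P {ω | A t ω = a} ≤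
      (∫⁻ ω, (if A t ω = a then (fun n : ℕ => ENNReal.ofReal (if (n : ℝ) ≤ x' then 1 else 0))
        (pulls (fun s => A s ω) t a) else 0) ∂P) +
      (∑ n ∈ Finset.range T,
        ENNReal.ofReal (Real.exp (-(gap D a / (3 * c)) * ((n + 1 : ℕ) : ℝ) ^ (1 - 1 / p))) *
          ∫⁻ ω, expError p c 1 (meanReward D a) (n + 1) (fun s => A s ω) (fun s => R s ω) a t ∂P) +
      ENNReal.ofReal y +
      P {ω | K ≤ t ∧ ∀ j, perturbedEstimate p c (fun s => A s ω) (fun s => R s ω)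
        (fun s => G s ω) t j < bestMean D - gap D a / 3} := by
    intro t ht
    have h0 : P {ω | A t ω = a} = ∫⁻ ω, (if A t ω = a then 1 else 0) ∂P := by
      rw [← lintegral_indicator_one (hmeasA t)]
      exact lintegral_congr fun ω => Set.indicator_apply _ _ _
    rw [h0]
    refine (lintegral_mono fun ω => choice_indicator_le hrun hp1 hc ha hx'
      (Finset.mem_range.1 ht) ω).trans ?_
    have hm1 := measurable_choice_weight hrun
      (fun n : ℕ => ENNReal.ofReal (if (n : ℝ) ≤ x' then 1 else 0)) a t
    rw [lintegral_add_right _ (measurable_one.indicator (hmeasB t)),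
      lintegral_add_right _ (measurable_one.indicator (hmeasG t _)),
      lintegral_add_left hm1, lintegral_indicator_one (hmeasB t),
      lintegral_indicator_one (hmeasG t _), lintegral_finsetSum, measure_le_pert_eq hrun]
    · gcongr with n _
      · exact (lintegral_const_mul' _ _ ENNReal.ofReal_ne_top).le
      -- The fixed count ⌊x'⌋ + 1 exceeds x', so its tail probability is at most y.
      · refine hxy' _ ?_
        push_cast
        exact Nat.lt_floor_add_one x'
    · exact fun n _ => (measurable_expError hrun _ _ _ _ _).const_mul _
  have hsum := Finset.sum_le_sum hterm
  rw [Finset.sum_add_distrib, Finset.sum_add_distrib, Finset.sum_add_distrib, Finset.sum_const,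
    Finset.card_range, nsmul_eq_mul] at hsum
  have h1 : ∑ t ∈ Finset.range T, ∫⁻ ω, (if A t ω = a then
      (fun n : ℕ => ENNReal.ofReal (if (n : ℝ) ≤ x' then 1 else 0))
        (pulls (fun s => A s ω) t a) else 0) ∂P ≤ ENNReal.ofReal (x' + 1) := by
    refine sum_lintegral_choice_weight_le hrun
      (f := fun n : ℕ => ENNReal.ofReal (if (n : ℝ) ≤ x' then 1 else 0)) (fun N _ => ?_) a
    rw [← ENNReal.ofReal_sum_of_nonneg fun n _ => by split_ifs <;> norm_num]
    exact ENNReal.ofReal_le_ofReal (sum_indicator_le hx' N)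
  have h2 := sum_weighted_expError_le hrun hp1 hp2 hc hD (Or.inl rfl) a
    (show 0 < gap D a / (3 * c) by positivity) he T
  have h3 := sum_measure_all_lt_le hrun hp1 hp2 hc hD hF hhalf hb ha hC hodds T hx hy hxy
  have h4 := hsum.trans (add_le_add (add_le_add (add_le_add h1 h2) le_rfl) h3)
  have h5 : (T : ℝ≥0∞) * ENNReal.ofReal y = ENNReal.ofReal (T * y) := by
    rw [ENNReal.ofReal_mul (by positivity), ENNReal.ofReal_natCast]
  rw [h5, ← ENNReal.ofReal_mul hC.le, ← ENNReal.ofReal_add (by positivity) (by positivity),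
    ← ENNReal.ofReal_add (by positivity) (by positivity),
    ← ENNReal.ofReal_add (by positivity) (by positivity),
    ← ENNReal.ofReal_add (by positivity) (by positivity)] at h4
  have h6 : ∑ t ∈ Finset.range T, P {ω | A t ω = a} =
      ENNReal.ofReal (∑ t ∈ Finset.range T, P.real {ω | A t ω = a}) := by
    rw [ENNReal.ofReal_sum_of_nonneg fun _ _ => measureReal_nonneg]
    simp
  rw [h6] at h4
  exact (ENNReal.ofReal_le_ofReal_iff (by positivity)).1 h4

end choices

/-! ### Regret -/

section regret

variable {K : ℕ} {D : Fin K → Measure ℝ}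

lemma gap_nonneg (a : Fin K) : 0 ≤ gap D a :=
  sub_nonneg.2 (le_ciSup (Set.finite_range (meanReward D)).bddAbove a)

lemma exists_meanReward_eq_bestMean [Nonempty (Fin K)] : ∃ b, meanReward D b = bestMean D := by
  obtain ⟨b, hb⟩ := Finite.exists_max (meanReward D)
  exact ⟨b, le_antisymm (le_ciSup (Set.finite_range (meanReward D)).bddAbove b) (ciSup_le hb)⟩

lemma expectedRegret_eq {Ω : Type*} [MeasurableSpace Ω] {P : Measure Ω} [IsProbabilityMeasure P]
    {A : ℕ → Ω → Fin K} (hA : ∀ t, Measurable (A t)) (T : ℕ) :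
    expectedRegret P D A T =
      ∑ a, gap D a * ∑ t ∈ Finset.range T, P.real {ω | A t ω = a} := by
  simp only [Finset.mul_sum]
  rw [Finset.sum_comm, expectedRegret]
  refine Finset.sum_congr rfl fun t _ => ?_
  have hprob : IsProbabilityMeasure (P.map (A t)) :=
    Measure.isProbabilityMeasure_map (hA t).aemeasurable
  have h1 : ∫ ω, meanReward D (A t ω) ∂P = ∑ a, P.real {ω | A t ω = a} * meanReward D a := by
    rw [← integral_map (f := meanReward D) (hA t).aemeasurable
      (by fun_prop), integral_fintype (Integrable.of_finite)]
    refine Finset.sum_congr rfl fun a _ => ?_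
    rw [map_measureReal_apply (hA t) (measurableSet_singleton a)]
    rfl
  have h2 : ∑ a, P.real {ω | A t ω = a} = 1 := by
    have := sum_measureReal_singleton (μ := P.map (A t)) Finset.univ
    simp only [Finset.coe_univ, probReal_univ] at this
    rw [← this]
    refine Finset.sum_congr rfl fun a _ => ?_
    rw [map_measureReal_apply (hA t) (measurableSet_singleton a)]
    rfl
  rw [h1]
  calc bestMean D - ∑ a, P.real {ω | A t ω = a} * meanReward D a
      = (∑ a, P.real {ω | A t ω = a}) * bestMean D -
          ∑ a, P.real {ω | A t ω = a} * meanReward D a := by rw [h2, one_mul]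
    _ = _ := by
        rw [Finset.sum_mul, ← Finset.sum_sub_distrib]
        refine Finset.sum_congr rfl fun a _ => ?_
        rw [gap]
        ring

end regret

end APE2

end
-- Choice of thresholds and the regret bound
theorem theorem3 :
    ∃ M : ℝ, 0 < M ∧
      ∀ (p c : ℝ) (νp : ℝ≥0) (μ : Measure ℝ) [IsProbabilityMeasure μ],
        1 < p → p ≤ 2 → 0 < c → APE2.PerturbationAssumption μ →
        ∃ C : ℝ, 0 < C ∧
          ∀ (K : ℕ) (D : Fin K → Measure ℝ) [∀ a, IsProbabilityMeasure (D a)],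
            (∀ a, ∫⁻ x, ENNReal.ofReal (|x| ^ p) ∂(D a) ≤ (νp : ℝ≥0∞)) →
            ∀ {Ω : Type*} [MeasurableSpace Ω] (P : Measure Ω) [IsProbabilityMeasure P]
              (R G : ℕ → Ω → Fin K → ℝ) (A : ℕ → Ω → Fin K),
              APE2.IsRun P p c D μ R G A →
              ∀ T : ℕ, 1 ≤ T →
                APE2.expectedRegret P D A T ≤
                  M * ∑ a : Fin K with 0 < APE2.gap D a,
                    APE2.armBound p c μ C T (APE2.gap D a) := by
  refine ⟨1, one_pos, fun p c νp μ _ hp1 hp2 hc hμ => ?_⟩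
  obtain ⟨C, hC, hodds⟩ := APE2.exists_odds_le hμ
  have hp' : 0 < p - 1 := by linarith
  have he : 0 < 1 - 1 / p := by
    rw [sub_pos, div_lt_one (by linarith)]
    exact hp1
  have heq : 1 / (1 - 1 / p) = p / (p - 1) := by
    have : p ≠ 0 := by linarith
    field_simp
  set q := p / (p - 1) with hq
  have hq0 : 0 < q := div_pos (by linarith) hp'
  have hΓ : 0 < Real.Gamma (q + 1) := Real.Gamma_pos_of_pos (by positivity)
  set V := Real.exp (APE2.bConst p * νp / c ^ p) * Real.Gamma (q + 1) with hV
  have hV0 : 0 < V := mul_pos (Real.exp_pos _) hΓ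
  -- The term 3c^q is Ty + 2Ty after scaling by Δ^q; the two terms with V come from overestimating
  -- `a` and underestimating the optimal arm.
  refine ⟨3 * c ^ q + V * ((3 * c) ^ q + C * (6 * c) ^ q), by positivity, ?_⟩
  intro K D _ hD Ω _ P _ R G A hrun T hT
  have hT0 : (0 : ℝ) < T := by exact_mod_cast hT
  have hΩ : Nonempty Ω := P.nonempty_of_neZero
  have hK : Nonempty (Fin K) := ⟨A 0 hΩ.some⟩
  obtain ⟨b, hb⟩ := APE2.exists_meanReward_eq_bestMean (D := D)
  rw [APE2.expectedRegret_eq hrun.measurable_A, one_mul, Finset.sum_filter]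
  refine Finset.sum_le_sum fun a _ => ?_
  rcases (APE2.gap_nonneg (D := D) a).eq_or_lt with h0 | ha
  · rw [← h0, zero_mul, if_neg (lt_irrefl _)]
  rw [if_pos ha]
  set Δ := APE2.gap D a with hΔ
  -- Tail probability y in each of T rounds costs Ty = c^q/Δ^q, free of T.
  set y := c ^ q / (T * Δ ^ q) with hy
  have hy0 : 0 < y := by positivity
  -- Beyond these counts the margins pass the quantiles of orders y and 1 - y. The left tail has 6c
  -- instead of 3c because the odds bound halves its margin.
  have hmain := APE2.sum_measure_choice_le hrun hp1 hp2 hc hD hμ.unbounded hμ.half hb ha hC hodds T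
    (x := (max (-APE2.pertInv μ y) 0 / (Δ / (6 * c))) ^ (1 / (1 - 1 / p)))
    (x' := (max (APE2.pertInv μ (1 - y)) 0 / (Δ / (3 * c))) ^ (1 / (1 - 1 / p)))
    (by positivity) (by positivity) hy0.le
    (fun n hn => by
      have h := APE2.lt_mul_rpow_of_lt (by positivity) he hn
      refine APE2.pertCDF_le_of_lt_pertInv hy0 ?_
      have h2 : Δ / (6 * c) * (n : ℝ) ^ (1 - 1 / p) =
          Δ / (3 * c) * (n : ℝ) ^ (1 - 1 / p) / 2 := by field_simp; ring
      rw [h2] at h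
      linarith)
    (fun n hn => by
      have h := APE2.lt_mul_rpow_of_lt (by positivity) he hn
      have := APE2.le_pertCDF_of_pertInv_lt (by linarith) h
      linarith)
  rw [show -1 / (1 - 1 / p) = -q by rw [← heq]; ring, heq, ← hΔ] at hmain
  have hz := fun z k : ℝ => fun hk : 0 < k => show (max z 0 / (Δ / k)) ^ q =
      k ^ q / Δ ^ q * max z 0 ^ q from by
    rw [show max z 0 / (Δ / k) = k / Δ * max z 0 by field_simp,
      Real.mul_rpow (by positivity) (le_max_right _ _), Real.div_rpow hk.le ha.le]
  have hn := fun k : ℝ => fun hk : 0 < k => show (Δ / k) ^ (-q) = k ^ q / Δ ^ q from by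
    rw [Real.rpow_neg (by positivity), Real.div_rpow ha.le hk.le, inv_div]
  rw [hz _ (6 * c) (by positivity), hz _ (3 * c) (by positivity), hn (6 * c) (by positivity),
    hn (3 * c) (by positivity)] at hmain
  have hTy : T * y = c ^ q / Δ ^ q := by
    rw [hy]
    field_simp
  -- As q - 1 = 1/(p-1), the factor Δ of the regret turns Δ^(-q) into Δ^(-1/(p-1)).
  have hΔq : Δ ^ q = Δ * Δ ^ (1 / (p - 1)) := by
    have : q = 1 + 1 / (p - 1) := by
      rw [hq]
      field_simp
      ring
    rw [this, Real.rpow_add ha, Real.rpow_one]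
  have hmul := mul_le_mul_of_nonneg_left hmain ha.le
  refine hmul.trans (le_of_eq ?_)
  rw [show (T : ℝ) * (2 * y) = 2 * (T * y) by ring, hTy, hΔq, APE2.armBound, ← hq, ← hy]
  have h1 : 0 < Δ ^ (1 / (p - 1)) := by positivity
  have hΔ0 : Δ ≠ 0 := ha.ne'
  rw [hV]
  field_simp
  ring
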